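/- Let $N \ge 1$ be an integer and consider the Hilbert space $\mathcal{X} = L^2(\mathbb{R}^N, |x|^{-2}\,dx)$ of complex-valued functions. Let $\mathcal{D} \subset \mathcal{X}$ be the complex linear span of the functions $r\omega \mapsto p(\omega) f(r)$ ($r > 0$, $|\omega| = 1$), where $p$ is a spherical harmonic on $S^{N-1}$ (the restriction of a homogeneous harmonic polynomial with complex coefficients) and $f \in C_{\mathrm{c}}^\infty((0,\infty))$. Let $T$ be the closure in $\mathcal{X}$ of the operator \[ \frac{1}{i}\Bigl(2\sum_{j=1}^N x_j \frac{\partial}{\partial x_j} + N - 2\Bigr) \] with domain $\mathcal{D}$. For a Borel function $\varphi : \mathbb{R} \to \mathbb{C}$, the operator $\varphi(T)$ is understood in the sense of the functional calculus: if $V : \mathcal{X} \to L^2(X, \mu)$ is a unitary map onto the $L^2$ space of a $\sigma$-finite measure space and $h : X \to \mathbb{R}$ is a measurable function such that $T = V^{-1} M_h V$, where $M_g$ denotes the operator $u \mapsto gu$ with domain $\{u \in L^2(X,\mu) : gu \in L^2(X,\mu)\}$, then $\varphi(T) = V^{-1} M_{\varphi \circ h} V$. Then $T$ has such a representation $(X,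 \mu, V, h)$, and for every $z \in \mathbb{C}$ and every such representation, the operator \[ \exp\Bigl(\frac{z}{i}\Bigl(2\sum_{j=1}^N x_j \frac{\partial}{\partial x_j} + N - 2\Bigr)\Bigr) := \varphi_z(T), \qquad \varphi_z(t) = e^{zt}, \] is a (possibly unbounded) normal operator on $\mathcal{X}$. It is bounded if and only if $\operatorname{Re} z = 0$, and in this case it is everywhere defined and unitary. -/

import Mathlib

open MeasureTheory Set Topology
open scoped ContDiff

/-! ### Unbounded operators on a Hilbert space -/

section Operators

variable {H : Type*} [NormedAddCommGroup H] [InnerProductSpace ℂ H]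

/-- A (possibly partially defined) operator is bounded on its domain. -/
def IsBoundedOperator (S : H →ₗ.[ℂ] H) : Prop :=
  ∃ C : ℝ, ∀ u : S.domain, ‖S u‖ ≤ C * ‖(u : H)‖

/-- `S` is everywhere defined and is a unitary operator. -/
def IsUnitaryOperator [CompleteSpace H] (S : H →ₗ.[ℂ] H) : Prop :=
  ∃ U ∈ unitary (H →L[ℂ] H), S = ((U : H →L[ℂ] H) : H →ₗ[ℂ] H).toPMap ⊤

/-- A normal operator: densely defined, closed, and `S* S = S S*` (including the domains of the
two compositions). -/
def IsNormalOperator [CompleteSpace H] (S : H →ₗ.[ℂ] H) : Prop :=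
  Dense (S.domain : Set H) ∧ S.IsClosed ∧
    ∀ u w : H, (∃ v, (u, v) ∈ S.graph ∧ (v, w) ∈ S.adjoint.graph) ↔
      (∃ v, (u, v) ∈ S.adjoint.graph ∧ (v, w) ∈ S.graph)

/-- The maximal operator of multiplication by `g` on `L²(X, μ)`, with domain
`{u ∈ L² | g u ∈ L²}`. -/
noncomputable def mulOperator {X : Type*} [MeasurableSpace X] (μ : Measure X) (g : X → ℂ) :
    Lp ℂ 2 μ →ₗ.[ℂ] Lp ℂ 2 μ where
  domain :=
    { carrier := {u | MemLp (fun x => g x * u x) 2 μ}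
      zero_mem' := by
        refine (memLp_congr_ae ?_).2 (MemLp.zero (ε := ℂ) (p := 2) (μ := μ))
        filter_upwards [Lp.coeFn_zero ℂ 2 μ] with x hx
        rw [hx]
        simp
      add_mem' := by
        intro u v hu hv
        refine (memLp_congr_ae ?_).2 (MemLp.add hu hv)
        filter_upwards [Lp.coeFn_add u v] with x hx
        rw [hx]
        simp [mul_add]
      smul_mem' := by
        intro c u hu
        refine (memLp_congr_ae ?_).2 (MemLp.const_smul hu c)
        filter_upwards [Lp.coeFn_smul c u] with x hx
        rw [hx]
        simp [mul_left_comm] }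
  toFun :=
    { toFun := fun u => MemLp.toLp (fun x => g x * (u : Lp ℂ 2 μ) x) u.2
      map_add' := by
        intro u v
        rw [← MemLp.toLp_add]
        refine MemLp.toLp_congr _ _ ?_
        filter_upwards [Lp.coeFn_add (u : Lp ℂ 2 μ) v] with x hx
        change g x * ((u : Lp ℂ 2 μ) + (v : Lp ℂ 2 μ) : Lp ℂ 2 μ) x = _
        rw [hx]
        simp [mul_add]
      map_smul' := by
        intro c u
        rw [RingHom.id_apply, ← MemLp.toLp_const_smul]
        refine MemLp.toLp_congr _ _ ?_
        filter_upwards [Lp.coeFn_smul c (u : Lp ℂ 2 μ)] with x hx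
        change g x * (c • (u : Lp ℂ 2 μ) : Lp ℂ 2 μ) x = _
        rw [hx]
        simp [mul_left_comm] }

/-- The operator `V⁻¹ M V` on `H`, for a unitary map `V : H → K` and an operator `M` on `K`. -/
noncomputable def conjOperator {K : Type*} [NormedAddCommGroup K] [InnerProductSpace ℂ K]
    (V : H ≃ₗᵢ[ℂ] K) (M : K →ₗ.[ℂ] K) : H →ₗ.[ℂ] H where
  domain := M.domain.comap (V.toLinearEquiv : H →ₗ[ℂ] K)
  toFun := (V.symm.toLinearEquiv : K →ₗ[ℂ] H) ∘ₗ M.toFun ∘ₗ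
    (V.toLinearEquiv : H →ₗ[ℂ] K).restrict (p := M.domain.comap (V.toLinearEquiv : H →ₗ[ℂ] K))
      (q := M.domain) (fun _ hx => hx)

/-- A spectral representation of an operator `T` on `H`: a unitary map `V` from `H` onto some
`L²(X, μ)` carrying `T` to the operator of multiplication by a real measurable function `h`. -/
structure SpectralRepresentation (T : H →ₗ.[ℂ] H) where
  X : Type
  [measurableSpace : MeasurableSpace X]
  μ : Measure X
  [sigmaFinite : SigmaFinite μ]
  V : H ≃ₗᵢ[ℂ] Lp ℂ 2 μ
  h : X → ℝ
  measurable_h : Measurable h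
  eq_conj : T = conjOperator V (mulOperator μ (fun x => (h x : ℂ)))

/-- The functional calculus: the operator `φ(T)`, that is, multiplication by `φ ∘ h` transported
to `H`, for a Borel function `φ` on the real line. -/
noncomputable def SpectralRepresentation.functionalCalculus {T : H →ₗ.[ℂ] H}
    (R : SpectralRepresentation T) (φ : ℝ → ℂ) : H →ₗ.[ℂ] H :=
  letI := R.measurableSpace
  conjOperator R.V (mulOperator R.μ (fun x => φ (R.h x)))

end Operators

/-! ### The space `L²(ℝ^N, |x|⁻² dx)` and the differential operator -/

section Euler

/-- The measure `|x|⁻² dx` on `ℝ^N`. -/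
noncomputable def weightedMeasure (N : ℕ) : Measure (EuclideanSpace ℝ (Fin N)) :=
  volume.withDensity (fun x => ENNReal.ofReal ((‖x‖ ^ 2)⁻¹))

/-- The Hilbert space `L²(ℝ^N, |x|⁻² dx)` of complex-valued functions. -/
abbrev WeightedL2 (N : ℕ) : Type := Lp ℂ 2 (weightedMeasure N)

/-- `C_c^∞(ℝ^N ∖ {0})`, the functions being extended by zero to the origin. -/
def puncturedTest (N : ℕ) : Submodule ℂ (EuclideanSpace ℝ (Fin N) → ℂ) where
  carrier := {F | ContDiff ℝ ∞ F ∧ HasCompactSupport F ∧ (0 : EuclideanSpace ℝ (Fin N)) ∉ tsupport F}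
  zero_mem' := ⟨contDiff_const, HasCompactSupport.zero, by
    simp [tsupport]⟩
  add_mem' := by
    rintro F G ⟨hF, hF', hF0⟩ ⟨hG, hG', hG0⟩
    refine ⟨hF.add hG, hF'.add hG', fun h => ?_⟩
    rcases tsupport_add F G h with h | h
    · exact hF0 h
    · exact hG0 h
  smul_mem' := by
    rintro c F ⟨hF, hF', hF0⟩
    refine ⟨contDiff_const.smul hF, hF'.smul_left (f := fun _ => c), fun h => hF0 ?_⟩
    exact tsupport_smul_subset_right (fun _ => c) F h

theorem puncturedTest_memLp {N : ℕ} {F : EuclideanSpace ℝ (Fin N) → ℂ}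
    (hF : F ∈ puncturedTest N) : MemLp F 2 (weightedMeasure N) := by
  obtain ⟨h1, h2, h3⟩ := hF
  obtain ⟨C, hC⟩ := h2.exists_bound_of_continuous h1.continuous
  have hK : IsCompact (tsupport F) := h2
  have hcont : ContinuousOn (fun x : EuclideanSpace ℝ (Fin N) => (‖x‖ ^ 2)⁻¹) (tsupport F) := by
    refine ContinuousOn.inv₀ (by fun_prop) (fun x hx => ?_)
    have : x ≠ 0 := fun h => h3 (h ▸ hx)
    positivity
  obtain ⟨M, hM⟩ := hK.exists_bound_of_continuousOn hcont
  have hfin : weightedMeasure N (tsupport F) < ⊤ := by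
    rw [weightedMeasure, withDensity_apply _ hK.measurableSet]
    calc ∫⁻ x in tsupport F, ENNReal.ofReal ((‖x‖ ^ 2)⁻¹)
        ≤ ∫⁻ _ in tsupport F, ENNReal.ofReal M := by
          refine setLIntegral_mono' hK.measurableSet (fun x hx => ENNReal.ofReal_le_ofReal ?_)
          exact (le_abs_self _).trans (hM x hx)
      _ = ENNReal.ofReal M * volume (tsupport F) := by simp
      _ < ⊤ := ENNReal.mul_lt_top ENNReal.ofReal_lt_top hK.measure_lt_top
  have : IsFiniteMeasure ((weightedMeasure N).restrict (tsupport F)) := ⟨by simpa using hfin⟩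
  have h : MemLp F 2 ((weightedMeasure N).restrict (tsupport F)) :=
    MemLp.of_bound h1.continuous.aestronglyMeasurable C (Filter.Eventually.of_forall hC)
  have h' := (memLp_indicator_iff_restrict hK.measurableSet).2 h
  rwa [indicator_eq_self.2 (subset_tsupport F)] at h'

/-- The class in `L²(ℝ^N, |x|⁻² dx)` of a test function. -/
noncomputable def puncturedTest.toL2 (N : ℕ) : puncturedTest N →ₗ[ℂ] WeightedL2 N where
  toFun F := (puncturedTest_memLp F.2).toLp F.1
  map_add' _ _ := rfl
  map_smul' _ _ := rfl

theorem puncturedTest.toL2_injective (N : ℕ) : Function.Injective (puncturedTest.toL2 N) := by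
  rw [injective_iff_map_eq_zero]
  rintro ⟨F, hF⟩ h
  have hae : F =ᵐ[weightedMeasure N] 0 := by
    have h1 := (puncturedTest_memLp hF).coeFn_toLp
    have h2 : (puncturedTest_memLp hF).toLp F = 0 := h
    rw [h2] at h1
    exact h1.symm.trans (Lp.coeFn_zero ℂ 2 _)
  have hnull : weightedMeasure N {x | F x ≠ 0} = 0 := hae
  rw [weightedMeasure, withDensity_apply_eq_zero (by fun_prop)] at hnull
  have hsub : {x | F x ≠ 0} ⊆
      {x | ENNReal.ofReal ((‖x‖ ^ 2)⁻¹) ≠ 0} ∩ {x | F x ≠ 0} := by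
    intro x hx
    refine ⟨?_, hx⟩
    have : x ≠ 0 := by
      rintro rfl
      exact hF.2.2 (subset_tsupport F hx)
    have : 0 < (‖x‖ ^ 2)⁻¹ := by positivity
    simpa using this.ne'
  have hopen : IsOpen {x | F x ≠ 0} := isOpen_ne_fun hF.1.continuous continuous_const
  have hempty := (hopen.measure_eq_zero_iff volume).1 (measure_mono_null hsub hnull)
  ext x
  by_contra hx
  have : x ∈ {x | F x ≠ 0} := hx
  rw [hempty] at this
  exact this

/-- The differential operator `2 ∑ x_j ∂_j + N - 2`. -/
noncomputable def eulerOperator (N : ℕ) (F : EuclideanSpace ℝ (Fin N) → ℂ) :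
    EuclideanSpace ℝ (Fin N) → ℂ :=
  fun x => 2 * ∑ j, (x j : ℂ) * fderiv ℝ F x (EuclideanSpace.single j 1) + ((N : ℂ) - 2) * F x

theorem eulerOperator_mem {N : ℕ} {F : EuclideanSpace ℝ (Fin N) → ℂ}
    (hF : F ∈ puncturedTest N) : eulerOperator N F ∈ puncturedTest N := by
  have hsub : tsupport (eulerOperator N F) ⊆ tsupport F := by
    refine closure_minimal (fun x hx => ?_) (isClosed_tsupport F)
    by_contra h
    have h1 : F x = 0 := image_eq_zero_of_notMem_tsupport h
    have h2 : fderiv ℝ F x = 0 :=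
      image_eq_zero_of_notMem_tsupport (fun h' => h (tsupport_fderiv_subset ℝ h'))
    exact hx (by simp [eulerOperator, h1, h2])
  refine ⟨?_, hF.2.1.mono' ((subset_tsupport _).trans hsub), fun h => hF.2.2 (hsub h)⟩
  have h1 : ContDiff ℝ ∞ (fderiv ℝ F) := hF.1.fderiv_right (m := ∞) (by simp)
  have h2 := hF.1
  have h3 : ∀ j : Fin N, ContDiff ℝ ∞ (fun x : EuclideanSpace ℝ (Fin N) => (x j : ℂ)) := fun j =>
    Complex.ofRealCLM.contDiff.comp (by fun_prop)
  unfold eulerOperator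
  refine ContDiff.add (contDiff_const.mul (ContDiff.sum fun j _ => (h3 j).mul ?_))
    (contDiff_const.mul h2)
  exact h1.clm_apply contDiff_const

/-- `2 ∑ x_j ∂_j + N - 2` as a linear map on test functions. -/
noncomputable def puncturedTest.euler (N : ℕ) : puncturedTest N →ₗ[ℂ] puncturedTest N where
  toFun F := ⟨eulerOperator N F.1, eulerOperator_mem F.2⟩
  map_add' := by
    rintro ⟨F, hF⟩ ⟨G, hG⟩
    ext x
    have h1 := (hF.1.differentiable (by simp)) x
    have h2 := (hG.1.differentiable (by simp)) x
    simp only [eulerOperator, Submodule.coe_add, fderiv_add h1 h2, Pi.add_apply,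
      _root_.add_apply, mul_add, Finset.sum_add_distrib]
    ring
  map_smul' := by
    rintro c ⟨F, hF⟩
    ext x
    have h1 := (hF.1.differentiable (by simp)) x
    simp only [eulerOperator, Submodule.coe_smul, fderiv_const_smul h1, Pi.smul_apply,
      _root_.smul_apply, smul_eq_mul, RingHom.id_apply, mul_add, Finset.mul_sum]
    congr 1
    · exact Finset.sum_congr rfl fun j _ => by ring
    · ring

/-- A homogeneous harmonic polynomial of degree `m`; the restrictions of these to the unit sphere
are the spherical harmonics of degree `m`. -/
def IsSolidHarmonic {N : ℕ} (m : ℕ) (p : MvPolynomial (Fin N) ℂ) : Prop :=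
  p.IsHomogeneous m ∧ ∑ j, MvPolynomial.pderiv j (MvPolynomial.pderiv j p) = 0

/-- `C_c^∞((0, ∞))`, the functions being extended by zero to the real line. -/
def IsRadialTest (f : ℝ → ℂ) : Prop :=
  ContDiff ℝ ∞ f ∧ HasCompactSupport f ∧ tsupport f ⊆ Ioi 0

/-- The function `r ω ↦ p(ω) f(r)`. -/
noncomputable def polarTensor {N : ℕ} (p : MvPolynomial (Fin N) ℂ) (f : ℝ → ℂ) :
    EuclideanSpace ℝ (Fin N) → ℂ :=
  fun x => MvPolynomial.eval (fun j => ((x j / ‖x‖ : ℝ) : ℂ)) p * f ‖x‖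

theorem polarTensor_mem {N : ℕ} (p : MvPolynomial (Fin N) ℂ) {f : ℝ → ℂ} (hf : IsRadialTest f) :
    polarTensor p f ∈ puncturedTest N := by
  obtain ⟨hf1, hf2, hf3⟩ := hf
  have hzero : polarTensor p f =ᶠ[𝓝 (0 : EuclideanSpace ℝ (Fin N))] 0 := by
    have h0 : (0 : ℝ) ∉ tsupport f := fun h => lt_irrefl (0 : ℝ) (hf3 h)
    have h1 := notMem_tsupport_iff_eventuallyEq.1 h0
    have h2 : Filter.Tendsto (fun x : EuclideanSpace ℝ (Fin N) => ‖x‖) (𝓝 0) (𝓝 0) := by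
      simpa using (continuous_norm (E := EuclideanSpace ℝ (Fin N))).tendsto 0
    filter_upwards [h2.eventually h1] with x hx
    simp only [polarTensor, hx, Pi.zero_apply, mul_zero]
  refine ⟨contDiff_iff_contDiffAt.2 fun x => ?_, ?_, notMem_tsupport_iff_eventuallyEq.2 hzero⟩
  · rcases eq_or_ne x 0 with rfl | hx
    · exact (contDiffAt_const (c := (0 : ℂ))).congr_of_eventuallyEq hzero
    · have hn : ContDiffAt ℝ ∞ (fun x : EuclideanSpace ℝ (Fin N) => ‖x‖) x := contDiffAt_norm ℝ hx
      refine ContDiffAt.mul ?_ (hf1.contDiffAt.comp x hn)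
      have hj : ∀ j : Fin N, ContDiffAt ℝ ∞
          (fun x : EuclideanSpace ℝ (Fin N) => ((x j / ‖x‖ : ℝ) : ℂ)) x := fun j =>
        Complex.ofRealCLM.contDiff.contDiffAt.comp x
          (ContDiffAt.div (by fun_prop) hn (norm_ne_zero_iff.2 hx))
      clear hzero
      induction p using MvPolynomial.induction_on with
      | C a => simpa using contDiffAt_const
      | add p q hp hq => simpa using hp.add hq
      | mul_X p j hp => simpa using hp.mul (hj j)
  · obtain ⟨R, hR⟩ := hf2.isBounded.subset_closedBall 0
    refine HasCompactSupport.intro (isCompact_closedBall (0 : EuclideanSpace ℝ (Fin N)) R) ?_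
    intro x hx
    have : ‖x‖ ∉ tsupport f := fun h => hx (by simpa using hR h)
    simp [polarTensor, image_eq_zero_of_notMem_tsupport this]

/-- The span of the functions `r ω ↦ p(ω) f(r)`, where `p` is a spherical harmonic and
`f ∈ C_c^∞((0, ∞))`. -/
noncomputable def harmonicCore (N : ℕ) : Submodule ℂ (puncturedTest N) :=
  Submodule.span ℂ {F | ∃ (m : ℕ) (p : MvPolynomial (Fin N) ℂ) (f : ℝ → ℂ) (hf : IsRadialTest f),
    IsSolidHarmonic m p ∧ F = ⟨polarTensor p f, polarTensor_mem p hf⟩}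

/-- `(1/i) (2 ∑ x_j ∂_j + N - 2)` on the domain `harmonicCore N`, in `L²(ℝ^N, |x|⁻² dx)`. -/
noncomputable def eulerCoreOperator (N : ℕ) : WeightedL2 N →ₗ.[ℂ] WeightedL2 N where
  domain := (harmonicCore N).map (puncturedTest.toL2 N)
  toFun := (1 / Complex.I) • (puncturedTest.toL2 N ∘ₗ puncturedTest.euler N ∘ₗ
    (harmonicCore N).subtype ∘ₗ
    ((Submodule.equivMapOfInjective (puncturedTest.toL2 N) (puncturedTest.toL2_injective N)
      (harmonicCore N)).symm : _ →ₗ[ℂ] harmonicCore N))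

/-- The closure of `(1/i) (2 ∑ x_j ∂_j + N - 2)`. -/
noncomputable def eulerClosure (N : ℕ) : WeightedL2 N →ₗ.[ℂ] WeightedL2 N :=
  (eulerCoreOperator N).closure

end Euler

/-! ### Multiplication operators -/

section Multiplication

variable {X : Type*} [MeasurableSpace X] {μ : Measure X} {g : X → ℂ}

/-! In logarithmic polar coordinates x = e^s ω the measure |x|⁻² dx becomes dσ(ω) e^{(N-2)s} ds. The
factor r^{-(N-2)/2} absorbs the density, so J_p v = p(ω) r^{-(N-2)/2} v(log r) is bounded from
L²(ℝ), and ⟨J_p v, J_q w⟩ is ⟨v, w⟩ times a constant depending only on p and q (`inner_logLiftL2`).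
The same factor absorbs the zeroth-order term: 2 ∑ x_j ∂_j + N - 2 acts on J_p v as 2 d/ds acts on v
(`LogRelated.eulerOperator_eq`).

A unitary of L²(ℝ) applied inside every J_p preserves all these inner products, so it extends to a
unitary of the whole space once the ranges of the J_p span a dense subspace. No orthonormal basis of
spherical harmonics is needed. The Fourier transform gives V with V T V⁻¹ equal to multiplication by
4π log|x| on the same space. Density (`harmonicCore_dense`) combines Weierstrass approximation with
the decomposition of polynomials into |x|^{2k} times harmonic ones.

That the closure of T on the core is the full multiplication operator S, and not a proper
restriction (`eulerClosure_eq`), is essential self-adjointness: S is symmetric, hence ‖(S + i)u‖² =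
‖Su‖² + ‖u‖², and (T + i) maps the core onto a dense subspace. The latter is an ordinary
differential equation v' - v/2 = ψ, solved approximately with compactly supported v.

Normality, and unitarity for Re z = 0, hold for any multiplication operator with the corresponding
multiplier. For the converse the representation is arbitrary, so the argument passes through the
quadratic form ⟨u, Tu⟩, which does not depend on it: a bounded e^{zT} forces Re z · h to be bounded
above, hence a one-sided bound on the form when Re z ≠ 0. The concrete representation shows that the
form takes normalized values in every interval. -/

theorem mem_mulOperator_graph_iff {u w : Lp ℂ 2 μ} :
    (u, w) ∈ (mulOperator μ g).graph ↔ (w : X → ℂ) =ᵐ[μ] fun x => g x * u x := by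
  rw [LinearPMap.mem_graph_iff]
  constructor
  · rintro ⟨y, hy, hw⟩
    simp only at hy hw
    subst hy
    rw [← hw]
    exact MemLp.coeFn_toLp y.2
  · intro h
    have hu : MemLp (fun x => g x * u x) 2 μ := (memLp_congr_ae h).1 (Lp.memLp w)
    refine ⟨⟨u, hu⟩, rfl, ?_⟩
    refine Lp.ext ?_
    exact (MemLp.coeFn_toLp hu).trans h.symm

/-- The restriction of `u` to the set where `‖g‖ ≤ n`. -/
noncomputable def truncate (g : X → ℂ) (hg : Measurable g) (n : ℝ) (u : Lp ℂ 2 μ) : Lp ℂ 2 μ :=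
  ((Lp.memLp u).indicator (measurableSet_le hg.norm measurable_const :
    MeasurableSet {x | ‖g x‖ ≤ n})).toLp _

theorem truncate_coe (hg : Measurable g) (n : ℝ) (u : Lp ℂ 2 μ) :
    (truncate g hg n u : X → ℂ) =ᵐ[μ] {x | ‖g x‖ ≤ n}.indicator u :=
  MemLp.coeFn_toLp _

theorem memLp_mul_of_bound_on {g : X → ℂ} (hg : Measurable g) {C : ℝ} {u : Lp ℂ 2 μ}
    (hu : ∀ᵐ x ∂μ, u x ≠ 0 → ‖g x‖ ≤ C) : MemLp (fun x => g x * u x) 2 μ := by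
  refine MemLp.of_le_mul (Lp.memLp u) (c := C)
    (hg.aestronglyMeasurable.mul (Lp.aestronglyMeasurable u)) ?_
  filter_upwards [hu] with x hx
  rw [norm_mul]
  by_cases h : u x = 0
  · simp [h]
  · exact mul_le_mul_of_nonneg_right (hx h) (norm_nonneg _)

theorem truncate_mem_domain {g' : X → ℂ} (hg : Measurable g) (hg' : Measurable g')
    (h : ∀ x, ‖g' x‖ ≤ ‖g x‖) (n : ℝ) (u : Lp ℂ 2 μ) :
    truncate g hg n u ∈ (mulOperator μ g').domain := by
  refine memLp_mul_of_bound_on hg' (C := n) ?_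
  filter_upwards [truncate_coe hg n u] with x hx hne
  rw [hx] at hne
  exact (h x).trans (show x ∈ {x | ‖g x‖ ≤ n} from mem_of_indicator_ne_zero hne)

theorem inner_truncate_left (hg : Measurable g) (n : ℝ) (u w : Lp ℂ 2 μ) :
    inner ℂ (truncate g hg n u) w = inner ℂ u (truncate g hg n w) := by
  rw [L2.inner_def, L2.inner_def]
  refine integral_congr_ae ?_
  filter_upwards [truncate_coe hg n u, truncate_coe hg n w] with x h1 h2
  rw [h1, h2]
  by_cases h : x ∈ {x | ‖g x‖ ≤ n}
  · rw [indicator_of_mem h, indicator_of_mem h]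
  · rw [indicator_of_notMem h, indicator_of_notMem h]; simp

/-- The sets {‖g‖ ≤ n} exhaust X. This removes the truncation at the end of each argument, and needs
no σ-finiteness. -/
theorem ae_of_forall_norm_le {p : X → Prop}
    (h : ∀ n : ℕ, ∀ᵐ x ∂μ, ‖g x‖ ≤ n → p x) : ∀ᵐ x ∂μ, p x := by
  filter_upwards [ae_all_iff.2 h] with x hx
  obtain ⟨n, hn⟩ := exists_nat_ge ‖g x‖
  exact hx n hn

/-- Truncations lie in the domain, so a vector orthogonal to the domain is orthogonal to its own
truncations, which therefore vanish. -/
theorem mulOperator_dense (hg : Measurable g) :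
    Dense ((mulOperator μ g).domain : Set (Lp ℂ 2 μ)) := by
  rw [Submodule.dense_iff_topologicalClosure_eq_top, Submodule.topologicalClosure_eq_top_iff,
    Submodule.eq_bot_iff]
  intro w hw
  refine Lp.ext ?_
  refine Filter.EventuallyEq.trans (g := fun _ => (0 : ℂ)) ?_ (Lp.coeFn_zero ℂ 2 μ).symm
  refine ae_of_forall_norm_le (g := g) fun n => ?_
  have h1 : truncate g hg n w = 0 := by
    rw [← inner_self_eq_zero (𝕜 := ℂ), inner_truncate_left]
    have h0 : truncate g hg n (truncate g hg n w) = truncate g hg n w := by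
      refine Lp.ext ?_
      filter_upwards [truncate_coe hg n (truncate g hg n w), truncate_coe hg n w] with x h1 h2
      rw [h1]
      by_cases h : x ∈ {x | ‖g x‖ ≤ n}
      · rw [indicator_of_mem h]
      · rw [indicator_of_notMem h, h2, indicator_of_notMem h]
    rw [h0, ← inner_conj_symm,
      hw _ (truncate_mem_domain hg hg (fun _ => le_rfl) n w), map_zero]
  have h2 := truncate_coe hg n w
  rw [h1] at h2
  filter_upwards [h2, Lp.coeFn_zero ℂ 2 μ] with x h3 h4 hx
  rw [h4] at h3
  rw [indicator_of_mem (show x ∈ {x | ‖g x‖ ≤ n} from hx)] at h3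
  exact h3.symm

theorem mem_adjoint_graph_iff {H : Type*} [NormedAddCommGroup H] [InnerProductSpace ℂ H]
    [CompleteSpace H] {S : H →ₗ.[ℂ] H} (hS : Dense (S.domain : Set H)) {y z : H} :
    (y, z) ∈ S.adjoint.graph ↔ ∀ a b, (a, b) ∈ S.graph → inner ℂ b y = inner ℂ a z := by
  rw [LinearPMap.adjoint_graph_eq_graph_adjoint hS, Submodule.mem_adjoint_iff]
  simp only [sub_eq_zero]

theorem mem_mulOperator_adjoint_graph_iff (hg : Measurable g) {u w : Lp ℂ 2 μ} :
    (u, w) ∈ (mulOperator μ g).adjoint.graph ↔ (w : X → ℂ) =ᵐ[μ] fun x => star (g x) * u x := by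
  rw [mem_adjoint_graph_iff (mulOperator_dense hg)]
  constructor
  · intro h
    refine ae_of_forall_norm_le (g := g) fun n => ?_
    have hmem : truncate g hg n u ∈ (mulOperator μ (fun x => star (g x))).domain :=
      truncate_mem_domain hg (by fun_prop) (fun x => by simp) n u
    set v : Lp ℂ 2 μ := MemLp.toLp _ hmem with hv
    have hvc : (v : X → ℂ) =ᵐ[μ] fun x => star (g x) * truncate g hg n u x := MemLp.coeFn_toLp hmem
    -- Truncation is a symmetric projection into the domain of M_g, so the adjoint relation may be
    -- tested on the truncation of an arbitrary vector.
    have key : truncate g hg n w = v := by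
      refine ext_inner_left ℂ fun a => ?_
      have hmem' := truncate_mem_domain hg hg (fun _ => le_rfl) n a
      have h1 := h (truncate g hg n a) (MemLp.toLp _ hmem')
        (mem_mulOperator_graph_iff.2 (MemLp.coeFn_toLp _))
      rw [← inner_truncate_left, ← h1, L2.inner_def, L2.inner_def]
      refine integral_congr_ae ?_
      filter_upwards [MemLp.coeFn_toLp hmem', hvc, truncate_coe hg n a, truncate_coe hg n u]
        with x h1 h2 h3 h4
      rw [h1, h2, h3, h4]
      by_cases hx : x ∈ {x | ‖g x‖ ≤ n}
      · rw [indicator_of_mem hx, indicator_of_mem hx]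
        simp; ring
      · rw [indicator_of_notMem hx, indicator_of_notMem hx]
        simp
    filter_upwards [hvc, truncate_coe hg n u, truncate_coe hg n w] with x h1 h2 h3 hx
    rw [key, h1, h2, indicator_of_mem (show x ∈ {x | ‖g x‖ ≤ n} from hx),
      indicator_of_mem (show x ∈ {x | ‖g x‖ ≤ n} from hx)] at h3
    exact h3.symm
  · intro h a b hab
    rw [mem_mulOperator_graph_iff] at hab
    rw [L2.inner_def, L2.inner_def]
    refine integral_congr_ae ?_
    filter_upwards [h, hab] with x h1 h2
    rw [h1, h2]
    simp; ring

theorem mulOperator_adjoint (hg : Measurable g) :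
    (mulOperator μ g).adjoint = mulOperator μ (fun x => star (g x)) := by
  refine LinearPMap.eq_of_eq_graph ?_
  ext ⟨u, w⟩
  rw [mem_mulOperator_adjoint_graph_iff hg, mem_mulOperator_graph_iff]

/-- M_g is the adjoint of multiplication by the conjugate of g, and adjoints are closed. -/
theorem mulOperator_isClosed (hg : Measurable g) : (mulOperator μ g).IsClosed := by
  have hg' : Measurable (fun x => star (g x)) := by fun_prop
  have h := LinearPMap.adjoint_isClosed (mulOperator_dense (μ := μ) hg')
  rw [mulOperator_adjoint hg'] at h
  simpa using h

theorem mulOperator_isNormal (hg : Measurable g) : IsNormalOperator (mulOperator μ g) := by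
  refine ⟨mulOperator_dense hg, mulOperator_isClosed hg, fun u w => ?_⟩
  simp only [mem_mulOperator_adjoint_graph_iff hg, mem_mulOperator_graph_iff]
  -- Multipliers of equal modulus have equal domains, and the products commute. Stated for a pair so
  -- that both directions of S*S = SS* are instances.
  have key : ∀ {f f' : X → ℂ}, Measurable f' → (∀ x, ‖f' x‖ = ‖f x‖) →
      (∃ v : Lp ℂ 2 μ, (v : X → ℂ) =ᵐ[μ] (fun x => f x * u x) ∧
        (w : X → ℂ) =ᵐ[μ] fun x => f' x * v x) →
      ∃ v : Lp ℂ 2 μ, (v : X → ℂ) =ᵐ[μ] (fun x => f' x * u x) ∧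
        (w : X → ℂ) =ᵐ[μ] fun x => f x * v x := by
    rintro f f' hf' hn ⟨v, h1, h2⟩
    have hm : MemLp (fun x => f' x * u x) 2 μ := by
      refine MemLp.of_le (Lp.memLp v)
        (hf'.aestronglyMeasurable.mul (Lp.aestronglyMeasurable u)) ?_
      filter_upwards [h1] with x hx
      rw [hx, norm_mul, norm_mul, hn]
    refine ⟨hm.toLp _, hm.coeFn_toLp, ?_⟩
    filter_upwards [h1, h2, hm.coeFn_toLp] with x h3 h4 h5
    rw [h4, h3, h5]
    ring
  exact ⟨key (by fun_prop) (by simp), key hg (by simp)⟩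

theorem norm_sq_eq_integral (u : Lp ℂ 2 μ) : ‖u‖ ^ 2 = ∫ x, ‖u x‖ ^ 2 ∂μ := by
  have h := inner_self_eq_norm_sq_to_K (𝕜 := ℂ) u
  rw [L2.inner_def] at h
  simp_rw [inner_self_eq_norm_sq_to_K] at h
  norm_cast at h
  exact_mod_cast h.symm

/-- A bounded multiplication operator lives where the multiplier is bounded. -/
theorem ae_norm_le_of_isBoundedOperator (hg : Measurable g)
    (h : IsBoundedOperator (mulOperator μ g)) :
    ∃ C : ℝ, ∀ u : Lp ℂ 2 μ, ∀ᵐ x ∂μ, u x ≠ 0 → ‖g x‖ ≤ C := by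
  obtain ⟨C, hC, h⟩ : ∃ C : ℝ, 0 ≤ C ∧
      ∀ u : (mulOperator μ g).domain, ‖mulOperator μ g u‖ ≤ C * ‖(u : Lp ℂ 2 μ)‖ := by
    obtain ⟨C, hC⟩ := h
    exact ⟨max C 0, le_max_right _ _, fun u => (hC u).trans
      (mul_le_mul_of_nonneg_right (le_max_left _ _) (norm_nonneg _))⟩
  refine ⟨C, fun u => ae_of_forall_norm_le (g := g) fun n => ?_⟩
  have hE : MeasurableSet {x | C < ‖g x‖} := measurableSet_lt measurable_const hg.norm
  -- This is u cut to C < ‖g‖ ≤ n. The upper cut puts v in the domain; the lower one gives ‖gv‖ >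
  -- C‖v‖ pointwise wherever v ≠ 0, so the operator bound forces v = 0.
  set v : Lp ℂ 2 μ := ((Lp.memLp (truncate g hg n u)).indicator hE).toLp _ with hv
  have hvc : (v : X → ℂ) =ᵐ[μ] {x | C < ‖g x‖}.indicator (truncate g hg n u) :=
    MemLp.coeFn_toLp _
  have hbd : ∀ᵐ x ∂μ, v x ≠ 0 → C < ‖g x‖ ∧ ‖g x‖ ≤ n := by
    filter_upwards [hvc, truncate_coe hg n u] with x h1 h2 h3
    rw [h1] at h3
    have h4 := mem_of_indicator_ne_zero h3
    rw [indicator_of_mem h4, h2] at h3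
    exact ⟨h4, show x ∈ {x | ‖g x‖ ≤ (n : ℝ)} from mem_of_indicator_ne_zero h3⟩
  have hvm : v ∈ (mulOperator μ g).domain :=
    memLp_mul_of_bound_on hg (hbd.mono fun x hx h => (hx h).2)
  have hCv := h ⟨v, hvm⟩
  set w := (mulOperator μ g) ⟨v, hvm⟩ with hw
  have hwc : (w : X → ℂ) =ᵐ[μ] fun x => g x * v x := MemLp.coeFn_toLp hvm
  have hv0 : ∀ᵐ x ∂μ, v x = 0 := by
    have i1 : Integrable (fun x => ‖v x‖ ^ 2) μ := (Lp.memLp v).norm.integrable_sq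
    have i2 : Integrable (fun x => ‖w x‖ ^ 2) μ := (Lp.memLp w).norm.integrable_sq
    have hint : ∫ x, (‖w x‖ ^ 2 - C ^ 2 * ‖v x‖ ^ 2) ∂μ ≤ 0 := by
      rw [integral_sub i2 (i1.const_mul _), integral_const_mul, ← norm_sq_eq_integral,
        ← norm_sq_eq_integral, ← mul_pow, sub_nonpos]
      exact pow_le_pow_left₀ (norm_nonneg _) hCv 2
    have hpos : 0 ≤ᵐ[μ] fun x => ‖w x‖ ^ 2 - C ^ 2 * ‖v x‖ ^ 2 := by
      filter_upwards [hwc, hbd] with x h1 h2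
      rw [h1, norm_mul, mul_pow, ← sub_mul]
      by_cases h3 : v x = 0
      · simp [h3]
      · exact mul_nonneg (sub_nonneg.2 (pow_le_pow_left₀ hC (h2 h3).1.le 2)) (sq_nonneg _)
    have hzero := (integral_eq_zero_iff_of_nonneg_ae hpos (i2.sub (i1.const_mul _))).1
      (le_antisymm hint (integral_nonneg_of_ae hpos))
    filter_upwards [hzero, hwc, hbd] with x h1 h2 h3
    by_contra h4
    rw [h2, norm_mul, mul_pow, ← sub_mul] at h1
    have h5 : 0 < ‖g x‖ ^ 2 - C ^ 2 := sub_pos.2 (pow_lt_pow_left₀ (h3 h4).1 hC two_ne_zero)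
    have h6 : 0 < ‖v x‖ := norm_pos_iff.2 h4
    exact (mul_pos h5 (pow_pos h6 2)).ne' h1
  filter_upwards [hv0, hvc, truncate_coe hg n u] with x h1 h2 h3 h4 h5
  by_contra h6
  rw [h1, indicator_of_mem (show x ∈ {x | C < ‖g x‖} from not_le.1 h6), h3,
    indicator_of_mem (show x ∈ {x | ‖g x‖ ≤ n} from h4)] at h2
  exact h5 h2.symm

/-- Multiplication by the conjugate of g is an everywhere defined inverse, and moduli are preserved
pointwise. -/
theorem mulOperator_isUnitary (hg : Measurable g) (h1 : ∀ x, ‖g x‖ = 1) :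
    ∃ W : Lp ℂ 2 μ ≃ₗᵢ[ℂ] Lp ℂ 2 μ, mulOperator μ g =
      (W.toLinearEquiv : Lp ℂ 2 μ →ₗ[ℂ] Lp ℂ 2 μ).toPMap ⊤ := by
  have hdom : ∀ {f : X → ℂ} (_ : Measurable f) (_ : ∀ x, ‖f x‖ = 1) (u : Lp ℂ 2 μ),
      u ∈ (mulOperator μ f).domain := fun hf h u =>
    memLp_mul_of_bound_on hf (C := 1) (Filter.Eventually.of_forall fun x _ => (h x).le)
  let L : ∀ {f : X → ℂ} (_ : Measurable f) (_ : ∀ x, ‖f x‖ = 1), Lp ℂ 2 μ →ₗ[ℂ] Lp ℂ 2 μ :=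
    fun {f} hf h => (mulOperator μ f).toFun ∘ₗ LinearMap.codRestrict _ LinearMap.id (hdom hf h)
  have hL : ∀ {f : X → ℂ} (hf : Measurable f) (h : ∀ x, ‖f x‖ = 1) (u : Lp ℂ 2 μ),
      (L hf h u : X → ℂ) =ᵐ[μ] fun x => f x * u x := fun hf h u => MemLp.coeFn_toLp (hdom hf h u)
  have hg' : Measurable fun x => star (g x) := by fun_prop
  have h1' : ∀ x, ‖star (g x)‖ = 1 := by simpa using h1
  have hinv : ∀ x, star (g x) * g x = 1 := fun x => by
    have := RCLike.conj_mul (g x)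
    rw [h1 x] at this
    simpa using this
  let e : Lp ℂ 2 μ ≃ₗ[ℂ] Lp ℂ 2 μ := LinearEquiv.ofLinearMap (L hg h1) (L hg' h1')
    (by
      ext1 u
      refine Lp.ext ?_
      filter_upwards [hL hg h1 (L hg' h1' u), hL hg' h1' u] with x e1 e2
      simp only [LinearMap.comp_apply, LinearMap.id_apply]
      rw [e1, e2, ← mul_assoc, mul_comm (g x), hinv, one_mul])
    (by
      ext1 u
      refine Lp.ext ?_
      filter_upwards [hL hg' h1' (L hg h1 u), hL hg h1 u] with x e1 e2
      simp only [LinearMap.comp_apply, LinearMap.id_apply]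
      rw [e1, e2, ← mul_assoc, hinv, one_mul])
  refine ⟨⟨e, fun u => ?_⟩, ?_⟩
  · rw [← sq_eq_sq₀ (norm_nonneg _) (norm_nonneg _), norm_sq_eq_integral, norm_sq_eq_integral]
    refine integral_congr_ae ?_
    filter_upwards [hL hg h1 u] with x hx
    change ‖L hg h1 u x‖ ^ 2 = _
    rw [hx, norm_mul, h1, one_mul]
  · refine LinearPMap.eq_of_eq_graph ?_
    ext ⟨u, w⟩
    rw [mem_mulOperator_graph_iff, LinearPMap.mem_graph_iff]
    constructor
    · intro h
      refine ⟨⟨u, trivial⟩, rfl, ?_⟩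
      refine Lp.ext ?_
      exact (hL hg h1 u).trans h.symm
    · rintro ⟨y, hy, hw⟩
      simp only at hy hw
      rw [← hw, ← hy]
      exact hL hg h1 y

end Multiplication

/-! ### Unitary conjugation -/

section Conjugation

variable {H K : Type*} [NormedAddCommGroup H] [InnerProductSpace ℂ H]
  [NormedAddCommGroup K] [InnerProductSpace ℂ K] {V : H ≃ₗᵢ[ℂ] K} {M : K →ₗ.[ℂ] K}

/-- Conjugation moves the graph by V × V. Closedness, adjoints and normality are transported through
this description, which avoids handling domains. -/
theorem mem_conjOperator_graph_iff {u w : H} :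
    (u, w) ∈ (conjOperator V M).graph ↔ (V u, V w) ∈ M.graph := by
  rw [LinearPMap.mem_graph_iff, LinearPMap.mem_graph_iff]
  constructor
  · rintro ⟨y, hy, hw⟩
    simp only at hy hw
    refine ⟨⟨V y, y.2⟩, by rw [← hy], ?_⟩
    rw [← hw]
    exact (V.apply_symm_apply _).symm
  · rintro ⟨y, hy, hw⟩
    simp only at hy hw
    have hu : V u ∈ M.domain := hy ▸ y.2
    refine ⟨⟨u, hu⟩, rfl, ?_⟩
    have hy' : y = ⟨V u, hu⟩ := Subtype.ext hy
    have : V.symm (M ⟨V u, hu⟩) = w := by rw [← hy', hw, V.symm_apply_apply]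
    exact this

theorem conjOperator_graph :
    ((conjOperator V M).graph : Set (H × H)) =
      (Homeomorph.prodCongr V.toHomeomorph V.toHomeomorph) ⁻¹' (M.graph : Set (K × K)) := by
  ext ⟨u, w⟩
  exact mem_conjOperator_graph_iff

theorem conjOperator_isClosed (hM : M.IsClosed) : (conjOperator V M).IsClosed := by
  rw [LinearPMap.IsClosed, conjOperator_graph]
  exact hM.preimage (Homeomorph.continuous _)

theorem conjOperator_dense (hM : Dense (M.domain : Set K)) :
    Dense ((conjOperator V M).domain : Set H) :=
  hM.preimage V.toHomeomorph.isOpenMap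

theorem mem_conjOperator_adjoint_graph_iff [CompleteSpace H] [CompleteSpace K]
    (hM : Dense (M.domain : Set K)) {u w : H} :
    (u, w) ∈ (conjOperator V M).adjoint.graph ↔ (V u, V w) ∈ M.adjoint.graph := by
  rw [mem_adjoint_graph_iff (conjOperator_dense hM), mem_adjoint_graph_iff hM]
  constructor
  · intro h a b hab
    have := h (V.symm a) (V.symm b) (mem_conjOperator_graph_iff.2 (by simpa using hab))
    rwa [← V.inner_map_map, ← V.inner_map_map (V.symm a), V.apply_symm_apply,
      V.apply_symm_apply] at this
  · intro h a b hab
    rw [← V.inner_map_map, ← V.inner_map_map a]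
    exact h _ _ (mem_conjOperator_graph_iff.1 hab)

theorem conjOperator_isNormal [CompleteSpace H] [CompleteSpace K] (hM : IsNormalOperator M) :
    IsNormalOperator (conjOperator V M) := by
  refine ⟨conjOperator_dense hM.1, conjOperator_isClosed hM.2.1, fun u w => ?_⟩
  simp only [mem_conjOperator_adjoint_graph_iff hM.1, mem_conjOperator_graph_iff]
  have h := hM.2.2 (V u) (V w)
  constructor
  · rintro ⟨v, hv⟩
    obtain ⟨v', hv'⟩ := h.1 ⟨V v, hv⟩
    exact ⟨V.symm v', by simpa using hv'⟩
  · rintro ⟨v, hv⟩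
    obtain ⟨v', hv'⟩ := h.2 ⟨V v, hv⟩
    exact ⟨V.symm v', by simpa using hv'⟩

theorem conjOperator_isBounded_iff :
    IsBoundedOperator (conjOperator V M) ↔ IsBoundedOperator M := by
  constructor
  · rintro ⟨C, hC⟩
    refine ⟨C, fun u => ?_⟩
    have hu : V (V.symm u) ∈ M.domain := by simp
    have h : ‖V.symm (M ⟨V (V.symm u), hu⟩)‖ ≤ C * ‖V.symm (u : K)‖ := hC ⟨V.symm u, hu⟩
    have he : (⟨V (V.symm u), hu⟩ : M.domain) = u := Subtype.ext (by simp)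
    rwa [he, V.symm.norm_map, V.symm.norm_map] at h
  · rintro ⟨C, hC⟩
    refine ⟨C, fun u => ?_⟩
    have h := hC ⟨V u, u.2⟩
    change ‖V.symm (M ⟨V u, u.2⟩)‖ ≤ _
    rw [V.symm.norm_map]
    simpa using h

theorem conjOperator_isUnitary [CompleteSpace H] (W : K ≃ₗᵢ[ℂ] K)
    (hM : M = (W.toLinearEquiv : K →ₗ[ℂ] K).toPMap ⊤) : IsUnitaryOperator (conjOperator V M) := by
  refine ⟨Unitary.linearIsometryEquiv.symm ((V.trans W).trans V.symm), SetLike.coe_mem _, ?_⟩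
  subst hM
  refine LinearPMap.eq_of_eq_graph ?_
  ext ⟨u, w⟩
  rw [mem_conjOperator_graph_iff, LinearPMap.mem_graph_iff, LinearPMap.mem_graph_iff]
  constructor
  · rintro ⟨y, hy, hw⟩
    simp only at hy hw
    refine ⟨⟨u, trivial⟩, rfl, ?_⟩
    change V.symm (W (V u)) = w
    rw [← hy]
    exact V.symm_apply_eq.2 hw
  · rintro ⟨y, hy, hw⟩
    simp only at hy hw
    refine ⟨⟨V u, trivial⟩, rfl, ?_⟩
    have hw' : V.symm (W (V y)) = w := hw
    rw [← hw', V.apply_symm_apply, hy]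
    rfl

end Conjugation

/-! ### Decomposition of homogeneous polynomials into harmonic ones -/

section Harmonic

open MvPolynomial

/-- The Laplacian of a polynomial. -/
noncomputable def polyLaplacian (N : ℕ) : MvPolynomial (Fin N) ℂ →ₗ[ℂ] MvPolynomial (Fin N) ℂ :=
  ∑ j, (pderiv j).toLinearMap ∘ₗ (pderiv j).toLinearMap

theorem polyLaplacian_apply {N : ℕ} (p : MvPolynomial (Fin N) ℂ) :
    polyLaplacian N p = ∑ j, pderiv j (pderiv j p) := by
  simp [polyLaplacian, LinearMap.sum_apply]

/-- The polynomial `∑ X_j ^ 2`. -/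
noncomputable def normSqPoly (N : ℕ) : MvPolynomial (Fin N) ℂ := ∑ j, X j ^ 2

theorem pderiv_normSqPoly {N : ℕ} (j : Fin N) : pderiv j (normSqPoly N) = 2 * X j := by
  classical
  simp only [normSqPoly, map_sum, pderiv_pow, pderiv_X]
  rw [Finset.sum_eq_single j]
  · simp
  · intro i _ hij
    simp [hij]
  · simp

theorem normSqPoly_isHomogeneous (N : ℕ) : (normSqPoly N).IsHomogeneous 2 :=
  IsHomogeneous.sum _ _ _ fun j _ => by simpa using (isHomogeneous_X ℂ j).pow 2

/-- Leibniz's rule gives 2f + 4 X_j ∂_j f for each j besides the main term; Euler's identity sums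
the first-order terms to 4d f. -/
theorem polyLaplacian_normSq_mul {N d : ℕ} {f : MvPolynomial (Fin N) ℂ} (hf : f.IsHomogeneous d) :
    polyLaplacian N (normSqPoly N * f) =
      normSqPoly N * polyLaplacian N f + ((2 * N + 4 * d : ℕ) : ℂ) • f := by
  have h : ∀ j, pderiv j (pderiv j (normSqPoly N * f)) =
      2 * f + 4 * (X j * pderiv j f) + normSqPoly N * pderiv j (pderiv j f) := by
    intro j
    have h2 : pderiv j (2 : MvPolynomial (Fin N) ℂ) = 0 := by
      rw [← map_ofNat (C : ℂ →+* MvPolynomial (Fin N) ℂ) 2, pderiv_C]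
    simp only [pderiv_mul, pderiv_normSqPoly, map_add, pderiv_X_self, h2]
    ring
  simp only [polyLaplacian_apply, h, Finset.sum_add_distrib, ← Finset.mul_sum,
    hf.sum_X_mul_pderiv]
  simp only [Finset.sum_const, Finset.card_univ, Fintype.card_fin,
    ← Nat.cast_smul_eq_nsmul ℂ, smul_eq_C_mul]
  simp only [map_natCast]
  push_cast
  ring

/-- Each factor ∑ X_j² adds a positive constant. Positivity of c is what allows the Laplacian to be
inverted on these products. -/
theorem polyLaplacian_normSq_pow_mul {N d : ℕ} (hN : 1 ≤ N) {f : MvPolynomial (Fin N) ℂ}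
    (hf : IsSolidHarmonic d f) (k : ℕ) :
    ∃ c : ℕ, 0 < c ∧ polyLaplacian N (normSqPoly N ^ (k + 1) * f) =
      (c : ℂ) • (normSqPoly N ^ k * f) := by
  induction k with
  | zero =>
    refine ⟨2 * N + 4 * d, by omega, ?_⟩
    have h0 : polyLaplacian N f = 0 := (polyLaplacian_apply f).trans hf.2
    rw [zero_add, pow_one, polyLaplacian_normSq_mul hf.1, h0]
    simp
  | succ k ih =>
    obtain ⟨c, hc, h⟩ := ih
    have hh : (normSqPoly N ^ (k + 1) * f).IsHomogeneous (2 * (k + 1) + d) :=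
      ((normSqPoly_isHomogeneous N).pow (k + 1)).mul hf.1
    refine ⟨c + (2 * N + 4 * (2 * (k + 1) + d)), by omega, ?_⟩
    rw [pow_succ' _ (k + 1), mul_assoc, polyLaplacian_normSq_mul hh, h, Nat.cast_add c, add_smul,
      mul_smul_comm, ← mul_assoc, ← pow_succ']

/-- The products `(∑ X_j ^ 2) ^ k * h` of degree `m`, with `h` harmonic. -/
def harmonicProducts (N m : ℕ) : Set (MvPolynomial (Fin N) ℂ) :=
  {p | ∃ (k d : ℕ) (f : MvPolynomial (Fin N) ℂ), IsSolidHarmonic d f ∧ 2 * k + d = m ∧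
    p = normSqPoly N ^ k * f}

theorem isHomogeneous_of_mem_span_harmonicProducts {N m : ℕ} {p : MvPolynomial (Fin N) ℂ}
    (hp : p ∈ Submodule.span ℂ (harmonicProducts N m)) : p.IsHomogeneous m := by
  rw [← mem_homogeneousSubmodule]
  refine Submodule.span_le.2 ?_ hp
  rintro _ ⟨k, d, f, hf, hm, rfl⟩
  have h := ((normSqPoly_isHomogeneous N).pow k).mul hf.1
  rw [hm] at h
  exact h

theorem exists_polyLaplacian_eq {N m : ℕ} (hN : 1 ≤ N) {p : MvPolynomial (Fin N) ℂ}
    (hp : p ∈ Submodule.span ℂ (harmonicProducts N m)) :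
    ∃ g ∈ Submodule.span ℂ (harmonicProducts N (m + 2)), polyLaplacian N g = p := by
  suffices h : Submodule.span ℂ (harmonicProducts N m) ≤
      (Submodule.span ℂ (harmonicProducts N (m + 2))).map (polyLaplacian N) from h hp
  refine Submodule.span_le.2 ?_
  rintro _ ⟨k, d, f, hf, hm, rfl⟩
  obtain ⟨c, hc, h⟩ := polyLaplacian_normSq_pow_mul hN hf k
  refine ⟨(c : ℂ)⁻¹ • (normSqPoly N ^ (k + 1) * f), Submodule.smul_mem _ _
    (Submodule.subset_span ⟨k + 1, d, f, hf, by omega, rfl⟩), ?_⟩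
  have hc' : (c : ℂ) ≠ 0 := by exact_mod_cast hc.ne'
  rw [map_smul, h, smul_smul, inv_mul_cancel₀ hc', one_smul]

theorem pderiv_eq_zero_of_isHomogeneous_zero {N : ℕ} {p : MvPolynomial (Fin N) ℂ}
    (hp : p.IsHomogeneous 0) (j : Fin N) : pderiv j p = 0 := by
  rw [totalDegree_eq_zero_iff_eq_C.1 ((totalDegree_zero_iff_isHomogeneous _).2 hp), pderiv_C]

/-- Induction in steps of two, degrees 0 and 1 being harmonic. By induction the Laplacian of p lies
in the span in degree m, so it is the Laplacian of some g in the span in degree m + 2; then p - g is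
harmonic. -/
theorem mem_span_harmonicProducts {N : ℕ} (hN : 1 ≤ N) (m : ℕ) :
    ∀ {p : MvPolynomial (Fin N) ℂ}, p.IsHomogeneous m →
      p ∈ Submodule.span ℂ (harmonicProducts N m) := by
  have base : ∀ {m : ℕ} {p : MvPolynomial (Fin N) ℂ}, p.IsHomogeneous m → polyLaplacian N p = 0 →
      p ∈ Submodule.span ℂ (harmonicProducts N m) := fun {m p} hp h =>
    Submodule.subset_span ⟨0, m, p, ⟨hp, (polyLaplacian_apply p).symm.trans h⟩, by omega, by simp⟩
  induction m using Nat.twoStepInduction with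
  | zero =>
    intro p hp
    refine base hp ?_
    simp [polyLaplacian_apply, pderiv_eq_zero_of_isHomogeneous_zero hp]
  | one =>
    intro p hp
    refine base hp ?_
    simp [polyLaplacian_apply, pderiv_eq_zero_of_isHomogeneous_zero (hp.pderiv)]
  | more m ih _ =>
    intro p hp
    have hL : (polyLaplacian N p).IsHomogeneous m := by
      rw [polyLaplacian_apply]
      exact IsHomogeneous.sum _ _ _ fun j _ => (hp.pderiv).pderiv
    obtain ⟨g, hg, hgp⟩ := exists_polyLaplacian_eq hN (ih hL)
    have h := base (hp.sub (isHomogeneous_of_mem_span_harmonicProducts hg))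
      (by rw [map_sub, hgp, sub_self])
    simpa using Submodule.add_mem _ h hg

theorem eval_smul_of_isHomogeneous {N d : ℕ} {p : MvPolynomial (Fin N) ℂ}
    (hp : p.IsHomogeneous d) (r : ℂ) (x : Fin N → ℂ) :
    eval (fun j => r * x j) p = r ^ d * eval x p := by
  rw [eval_eq', eval_eq', Finset.mul_sum]
  refine Finset.sum_congr rfl fun s hs => ?_
  rw [hp.degree_eq_sum_deg_support hs]
  simp only [mul_pow, Finset.prod_mul_distrib, Finset.prod_pow_eq_pow_sum]
  have h : ∑ i ∈ s.support, s i = ∑ i, s i :=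
    Finset.sum_subset (Finset.subset_univ _) fun i _ hi => by simpa using hi
  rw [h]
  ring

theorem IsRadialTest.pow_mul {f : ℝ → ℂ} (hf : IsRadialTest f) (m : ℕ) :
    IsRadialTest (fun r => (r : ℂ) ^ m * f r) := by
  refine ⟨?_, hf.2.1.mul_left, (tsupport_mul_subset_right).trans hf.2.2⟩
  exact (Complex.ofRealCLM.contDiff.pow m).mul hf.1

/-- The product of a polynomial and a radial function. -/
noncomputable def polyMulRadial (N : ℕ) (f : ℝ → ℂ) :
    MvPolynomial (Fin N) ℂ →ₗ[ℂ] (EuclideanSpace ℝ (Fin N) → ℂ) where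
  toFun p := fun x => eval (fun j => (x j : ℂ)) p * f ‖x‖
  map_add' p q := by
    ext x
    simp [add_mul]
  map_smul' c p := by
    ext x
    simp [mul_assoc]

/-- For q harmonic of degree d, |x|^{2k} q(x) f(|x|) = q(ω) r^{2k+d} f(r), and the power of r is
absorbed into the radial test function. -/
theorem polyMulRadial_mem {N : ℕ} (hN : 1 ≤ N) {f : ℝ → ℂ} (hf : IsRadialTest f)
    (p : MvPolynomial (Fin N) ℂ) :
    ∃ F ∈ harmonicCore N, (F : EuclideanSpace ℝ (Fin N) → ℂ) = polyMulRadial N f p := by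
  suffices h : ∀ m, Submodule.span ℂ (harmonicProducts N m) ≤
      ((harmonicCore N).map (puncturedTest N).subtype).comap (polyMulRadial N f) by
    have h2 : p ∈ ((harmonicCore N).map (puncturedTest N).subtype).comap (polyMulRadial N f) := by
      rw [← sum_homogeneousComponent p]
      exact Submodule.sum_mem _ fun i _ =>
        h i (mem_span_harmonicProducts hN i (homogeneousComponent_isHomogeneous i p))
    obtain ⟨F, hF, h3⟩ := h2
    exact ⟨F, hF, h3⟩
  intro m
  refine Submodule.span_le.2 ?_
  rintro _ ⟨k, d, q, hq, -, rfl⟩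
  refine ⟨⟨polarTensor q _, polarTensor_mem q (hf.pow_mul (2 * k + d))⟩,
    Submodule.subset_span ⟨d, q, _, hf.pow_mul (2 * k + d), hq, rfl⟩, ?_⟩
  ext x
  simp only [Submodule.subtype_apply, polarTensor, polyMulRadial, LinearMap.coe_mk, AddHom.coe_mk,
    map_mul, map_pow]
  have h1 : eval (fun j => (x j : ℂ)) (normSqPoly N) = (‖x‖ : ℂ) ^ 2 := by
    simp only [normSqPoly, map_sum, map_pow, eval_X]
    rw [← Complex.ofReal_pow, EuclideanSpace.norm_sq_eq]
    simp
  rcases eq_or_ne x 0 with rfl | hx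
  · have : f 0 = 0 := image_eq_zero_of_notMem_tsupport fun h => lt_irrefl (0 : ℝ) (hf.2.2 h)
    simp [this]
  have h2 : eval (fun j => (x j : ℂ)) q =
      (‖x‖ : ℂ) ^ d * eval (fun j => ((x j / ‖x‖ : ℝ) : ℂ)) q := by
    rw [← eval_smul_of_isHomogeneous hq.1]
    have hn : (‖x‖ : ℂ) ≠ 0 := by exact_mod_cast norm_ne_zero_iff.2 hx
    congr 2
    ext j
    rw [Complex.ofReal_div, mul_div_cancel₀ _ hn]
  rw [h1, h2]
  ring

end Harmonic

/-! ### Density of the core -/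

section Density

theorem weightedMeasure_lt_top {N : ℕ} {K : Set (EuclideanSpace ℝ (Fin N))} (hK : IsCompact K)
    (h0 : 0 ∉ K) : weightedMeasure N K < ⊤ := by
  have hcont : ContinuousOn (fun x : EuclideanSpace ℝ (Fin N) => (‖x‖ ^ 2)⁻¹) K := by
    refine ContinuousOn.inv₀ (by fun_prop) (fun x hx => ?_)
    have : x ≠ 0 := fun h => h0 (h ▸ hx)
    positivity
  obtain ⟨M, hM⟩ := hK.exists_bound_of_continuousOn hcont
  rw [weightedMeasure, withDensity_apply _ hK.measurableSet]
  calc ∫⁻ x in K, ENNReal.ofReal ((‖x‖ ^ 2)⁻¹)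
      ≤ ∫⁻ _ in K, ENNReal.ofReal M := by
        refine setLIntegral_mono' hK.measurableSet (fun x hx => ENNReal.ofReal_le_ofReal ?_)
        exact (le_abs_self _).trans (hM x hx)
    _ = ENNReal.ofReal M * volume K := by simp
    _ < ⊤ := ENNReal.mul_lt_top ENNReal.ofReal_lt_top hK.measure_lt_top

theorem ae_ne_zero_weightedMeasure {N : ℕ} (hN : 1 ≤ N) : ∀ᵐ x ∂weightedMeasure N, x ≠ 0 := by
  have : Nonempty (Fin N) := ⟨⟨0, hN⟩⟩
  refine (withDensity_absolutelyContinuous _ _).ae_le ?_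
  exact Measure.ae_ne volume 0

/-- The Weierstrass approximation theorem on compact subsets of `ℝ^N`. -/
theorem exists_mvPolynomial_near {N : ℕ} {K : Set (EuclideanSpace ℝ (Fin N))} (hK : IsCompact K)
    {g : EuclideanSpace ℝ (Fin N) → ℝ} (hg : Continuous g) {ε : ℝ} (hε : 0 < ε) :
    ∃ p : MvPolynomial (Fin N) ℝ, ∀ x ∈ K, |MvPolynomial.eval x p - g x| < ε := by
  let coord : Fin N → C(EuclideanSpace ℝ (Fin N), ℝ) := fun j => ⟨fun x => x j, by fun_prop⟩
  let A : Subalgebra ℝ C(EuclideanSpace ℝ (Fin N), ℝ) := (MvPolynomial.aeval coord).range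
  have hA : A.SeparatesPoints := by
    intro x y hxy
    obtain ⟨j, hj⟩ : ∃ j, x j ≠ y j := by
      by_contra! h
      exact hxy (by ext j; exact h j)
    exact ⟨coord j, ⟨coord j, ⟨MvPolynomial.X j, by simp⟩, rfl⟩, hj⟩
  obtain ⟨_, ⟨p, rfl⟩, hf⟩ :=
    ContinuousMap.exists_mem_subalgebra_near_continuous_of_isCompact_of_separatesPoints
      hA ⟨g, hg⟩ hK hε
  refine ⟨p, fun x hx => ?_⟩
  have h : (MvPolynomial.aeval coord p) x = MvPolynomial.eval x p := by
    clear hf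
    induction p using MvPolynomial.induction_on with
    | C a => simp [coord]
    | add p q hp hq => simp [hp, hq]
    | mul_X p j hp => simp [hp, coord]
  have h2 := hf x hx
  rwa [← h]

theorem exists_radial_cutoff {a b : ℝ} (ha : 0 < a) (hab : a ≤ b) :
    ∃ χ : ℝ → ℝ, IsRadialTest (fun r => (χ r : ℂ)) ∧ (∀ r ∈ Icc a b, χ r = 1) ∧
      (∀ r, 0 ≤ χ r ∧ χ r ≤ 1) ∧ ∀ r, χ r ≠ 0 → r ∈ Icc (a / 2) (b + a / 2) := by
  -- The outer ball is exactly [a/2, b + a/2]. The extra a/4 keeps the inner radius positive when a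
  -- = b.
  let χ : ContDiffBump ((a + b) / 2) :=
    { rIn := (b - a) / 2 + a / 4, rOut := (b - a) / 2 + a / 2,
      rIn_pos := by linarith, rIn_lt_rOut := by linarith }
  have hsupp : tsupport χ = Icc (a / 2) (b + a / 2) := by
    rw [χ.tsupport_eq, Real.closedBall_eq_Icc]
    congr 1 <;> simp only [χ] <;> ring
  have hsub : tsupport (fun r => (χ r : ℂ)) ⊆ tsupport χ :=
    closure_mono fun r hr h => hr (by simp [h])
  refine ⟨χ, ⟨Complex.ofRealCLM.contDiff.comp χ.contDiff, ?_, ?_⟩, ?_,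
    fun r => ⟨χ.nonneg, χ.le_one⟩, ?_⟩
  · exact χ.hasCompactSupport.mono' ((subset_tsupport _).trans hsub)
  · refine hsub.trans ?_
    rw [hsupp]
    intro r hr
    exact lt_of_lt_of_le (by linarith) hr.1
  · intro r hr
    refine χ.one_of_mem_closedBall ?_
    rw [Real.closedBall_eq_Icc]
    simp only [χ]
    exact ⟨by linarith [hr.1], by linarith [hr.2]⟩
  · intro r hr
    rw [← hsupp]
    exact subset_tsupport _ hr

/-- A punctured test function is uniformly approximated by elements of the core living on a fixed
compact set. -/
theorem exists_core_near {N : ℕ} (hN : 1 ≤ N) {g : EuclideanSpace ℝ (Fin N) → ℝ}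
    (hg : Continuous g) (hgc : HasCompactSupport g) (hg0 : 0 ∉ tsupport g) :
    ∃ K : Set (EuclideanSpace ℝ (Fin N)), IsCompact K ∧ 0 ∉ K ∧ ∀ ε > 0,
      ∃ F ∈ harmonicCore N, ∃ G : EuclideanSpace ℝ (Fin N) → ℝ, (∀ x, F.1 x = G x) ∧
        ∀ x, |G x - g x| ≤ K.indicator (fun _ => ε) x := by
  obtain ⟨a, ha, hag⟩ : ∃ a > 0, ∀ x ∈ tsupport g, a ≤ ‖x‖ := by
    obtain ⟨a, ha, h⟩ := Metric.isOpen_iff.1 (isClosed_tsupport g).isOpen_compl 0 hg0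
    refine ⟨a, ha, fun x hx => ?_⟩
    by_contra! h'
    exact h (by simpa using h') hx
  obtain ⟨b, hab, hbg⟩ : ∃ b, a ≤ b ∧ ∀ x ∈ tsupport g, ‖x‖ ≤ b := by
    obtain ⟨b, h⟩ := hgc.isBounded.exists_norm_le
    exact ⟨max a b, le_max_left _ _, fun x hx => (h x hx).trans (le_max_right _ _)⟩
  obtain ⟨χ, hχ, h1, h01, hs⟩ := exists_radial_cutoff ha hab
  have hKc : IsCompact {x : EuclideanSpace ℝ (Fin N) | ‖x‖ ∈ Icc (a / 2) (b + a / 2)} := by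
    refine (isCompact_closedBall (0 : EuclideanSpace ℝ (Fin N)) (b + a / 2)).of_isClosed_subset
      (isClosed_Icc.preimage continuous_norm) fun x hx => ?_
    simpa using hx.2
  refine ⟨_, hKc, fun h => ?_, fun ε hε => ?_⟩
  · have h2 := h.1
    rw [norm_zero] at h2
    linarith
  obtain ⟨p, hp⟩ := exists_mvPolynomial_near hKc hg hε
  obtain ⟨F, hF, hFp⟩ := polyMulRadial_mem hN hχ (p.map Complex.ofRealHom)
  refine ⟨F, hF, fun x => MvPolynomial.eval x p * χ ‖x‖, fun x => ?_, fun x => ?_⟩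
  · rw [hFp]
    simp only [polyMulRadial, LinearMap.coe_mk, AddHom.coe_mk, MvPolynomial.eval_map]
    rw [Complex.ofReal_mul]
    congr 1
    exact MvPolynomial.eval₂_comp_left Complex.ofRealHom (RingHom.id ℝ) x p |>.symm
  -- Since χ = 1 on the support of g, the error is (p - g)χ: it lives on K and is at most ε because
  -- 0 ≤ χ ≤ 1.
  · have hgχ : g x = g x * χ ‖x‖ := by
      by_cases hx : x ∈ tsupport g
      · rw [h1 _ ⟨hag x hx, hbg x hx⟩, mul_one]
      · rw [image_eq_zero_of_notMem_tsupport hx, zero_mul]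
    rw [hgχ, ← sub_mul, abs_mul, abs_of_nonneg (h01 _).1]
    by_cases hx : χ ‖x‖ = 0
    · rw [hx, mul_zero]
      exact indicator_nonneg (fun _ _ => hε.le) x
    · have hxK := hs _ hx
      rw [indicator_of_mem (show x ∈ {x | ‖x‖ ∈ Icc (a / 2) (b + a / 2)} from hxK)]
      calc _ ≤ ε * 1 := mul_le_mul (hp x hxK).le (h01 _).2 (h01 _).1 hε.le
        _ = ε := mul_one ε

theorem integrableOn_of_isCompact {N : ℕ} (w : WeightedL2 N) {K : Set (EuclideanSpace ℝ (Fin N))}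
    (hK : IsCompact K) (h0 : 0 ∉ K) : IntegrableOn w K (weightedMeasure N) := by
  have : IsFiniteMeasure ((weightedMeasure N).restrict K) :=
    ⟨by simpa using weightedMeasure_lt_top hK h0⟩
  exact ((Lp.memLp w).restrict K).integrable one_le_two

/-- A vector w orthogonal to the core is locally integrable off the origin. Uniform approximation on
a fixed compact set shows that w integrates to zero against every punctured test function, so w = 0
almost everywhere. -/
theorem harmonicCore_dense {N : ℕ} (hN : 1 ≤ N) :
    Dense (((harmonicCore N).map (puncturedTest.toL2 N) : Submodule ℂ (WeightedL2 N)) :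
      Set (WeightedL2 N)) := by
  rw [Submodule.dense_iff_topologicalClosure_eq_top, Submodule.topologicalClosure_eq_top_iff,
    Submodule.eq_bot_iff]
  intro w hw
  have hloc : LocallyIntegrableOn w {0}ᶜ (weightedMeasure N) := by
    rw [locallyIntegrableOn_iff isOpen_compl_singleton.isLocallyClosed]
    exact fun K hKs hK => integrableOn_of_isCompact w hK fun h => hKs h rfl
  have key := isOpen_compl_singleton.ae_eq_zero_of_integral_contDiff_smul_eq_zero hloc ?_
  · refine Lp.ext ?_
    filter_upwards [key, ae_ne_zero_weightedMeasure hN, Lp.coeFn_zero ℂ 2 (weightedMeasure N)]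
      with x h1 h2 h3
    rw [h1 h2, h3]
    rfl
  intro g hg hgc hgs
  obtain ⟨K, hK, hK0, happ⟩ := exists_core_near hN hg.continuous hgc fun h => hgs h rfl
  have hwK := integrableOn_of_isCompact w hK hK0
  have hbound : ∀ ε > 0, ‖∫ x, g x • w x ∂weightedMeasure N‖ ≤
      ε * ∫ x in K, ‖w x‖ ∂weightedMeasure N := by
    intro ε hε
    obtain ⟨F, hF, G, hFG, hGg⟩ := happ ε hε
    have h0 : ∫ x, (G x : ℂ) * w x ∂weightedMeasure N = 0 := by
      rw [← hw _ ⟨F, hF, rfl⟩, L2.inner_def]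
      refine integral_congr_ae ?_
      filter_upwards [(puncturedTest_memLp F.2).coeFn_toLp] with x hx
      change _ = inner ℂ ((puncturedTest_memLp F.2).toLp F.1 x) (w x)
      rw [hx, hFG]
      simp [mul_comm]
    have hdom : IntegrableOn (fun x => ε * ‖w x‖) K (weightedMeasure N) := hwK.norm.const_mul ε
    have hle : ∀ x, ‖(((G x - g x : ℝ) : ℂ)) * w x‖ ≤ K.indicator (fun x => ε * ‖w x‖) x := by
      intro x
      rw [norm_mul, Complex.norm_real, Real.norm_eq_abs]
      have := hGg x
      by_cases hx : x ∈ K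
      · rw [indicator_of_mem hx] at this ⊢
        exact mul_le_mul_of_nonneg_right this (norm_nonneg _)
      · rw [indicator_of_notMem hx] at this ⊢
        rw [le_antisymm this (abs_nonneg _), zero_mul]
    have hG : Integrable (fun x => (G x : ℂ) * w x) (weightedMeasure N) := by
      have h1 : MemLp (fun x => (G x : ℂ)) 2 (weightedMeasure N) :=
        (memLp_congr_ae (Filter.Eventually.of_forall hFG)).1 (puncturedTest_memLp F.2)
      exact h1.integrable_mul (Lp.memLp w)
    have hg2 : MemLp (fun x => (g x : ℂ)) 2 (weightedMeasure N) := by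
      refine puncturedTest_memLp ⟨Complex.ofRealCLM.contDiff.comp hg, ?_, fun h => ?_⟩
      · exact hgc.comp_left (g := ((↑) : ℝ → ℂ)) rfl
      · exact hgs (tsupport_comp_subset (g := ((↑) : ℝ → ℂ)) rfl g h) rfl
    have hgi : Integrable (fun x => (g x : ℂ) * w x) (weightedMeasure N) :=
      hg2.integrable_mul (Lp.memLp w)
    calc ‖∫ x, g x • w x ∂weightedMeasure N‖
        = ‖∫ x, ((G x - g x : ℝ) : ℂ) * w x ∂weightedMeasure N‖ := by
          simp only [Complex.ofReal_sub, sub_mul]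
          rw [integral_sub hG hgi, h0, zero_sub, norm_neg]
          rfl
      _ ≤ ∫ x, K.indicator (fun x => ε * ‖w x‖) x ∂weightedMeasure N :=
          norm_integral_le_of_norm_le ((integrable_indicator_iff hK.measurableSet).2 hdom)
            (Filter.Eventually.of_forall hle)
      _ = ε * ∫ x in K, ‖w x‖ ∂weightedMeasure N := by
          rw [integral_indicator hK.measurableSet, integral_const_mul]
  rw [← norm_eq_zero]
  refine le_antisymm (le_of_forall_pos_le_add fun δ hδ => ?_) (norm_nonneg _)
  have hI : 0 ≤ ∫ x in K, ‖w x‖ ∂weightedMeasure N := integral_nonneg fun _ => norm_nonneg _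
  rw [zero_add]
  -- The 1 in the denominator covers the case where the integral vanishes.
  refine (hbound (δ / (1 + ∫ x in K, ‖w x‖ ∂weightedMeasure N)) (by positivity)).trans ?_
  rw [div_mul_eq_mul_div, div_le_iff₀ (by positivity)]
  nlinarith

end Density

/-! ### Analysis on the line -/

section Line

open SchwartzMap FourierTransform

theorem exists_primitive {η : ℝ → ℂ} (hη : ContDiff ℝ ∞ η) (hc : HasCompactSupport η) :
    ∃ (P : ℝ → ℂ) (R : ℝ), ContDiff ℝ ∞ P ∧ deriv P = η ∧
      ∀ s t, (R ≤ s ∧ R ≤ t ∨ s ≤ -R ∧ t ≤ -R) → P s = P t := by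
  have hd : ∀ s, HasDerivAt (fun s => ∫ t in (0 : ℝ)..s, η t) (η s) s := fun s =>
    intervalIntegral.integral_hasDerivAt_right (hη.continuous.intervalIntegrable _ _)
      (hη.continuous.stronglyMeasurableAtFilter _ _) hη.continuous.continuousAt
  have hderiv : deriv (fun s => ∫ t in (0 : ℝ)..s, η t) = η := funext fun s => (hd s).deriv
  obtain ⟨R, hR⟩ := hc.isBounded.exists_norm_le
  -- The + 1 makes the separation from the support strict, as `uIoc` contains its right endpoint.
  refine ⟨_, R + 1, contDiff_infty_iff_deriv.2 ⟨fun s => (hd s).differentiableAt, ?_⟩, hderiv, ?_⟩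
  · rw [hderiv]
    exact hη
  intro s t hst
  rw [← sub_eq_zero, intervalIntegral.integral_interval_sub_left
    (hη.continuous.intervalIntegrable _ _) (hη.continuous.intervalIntegrable _ _)]
  refine intervalIntegral.integral_zero_ae (Filter.Eventually.of_forall fun x hx => ?_)
  refine image_eq_zero_of_notMem_tsupport fun h => ?_
  have h1 := hR x h
  rw [Real.norm_eq_abs, abs_le] at h1
  rw [mem_uIoc] at hx
  rcases hst with h2 | h2 <;> rcases hx with h3 | h3 <;>
    linarith [h1.1, h1.2, h2.1, h2.2, h3.1, h3.2]

/-- For `ψ` a test function, `ψ - e^{a/2} ψ(· - a)` is of the form `v' - v / 2`. -/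
theorem exists_solution {ψ : ℝ → ℂ} (hψ : ContDiff ℝ ∞ ψ) (hc : HasCompactSupport ψ) (a : ℝ) :
    ∃ v : 𝓢(ℝ, ℂ), HasCompactSupport v ∧ ∀ s, deriv v s - (1 / 2 : ℂ) * v s =
      ψ s - Real.exp (a / 2) * ψ (s - a) := by
  have hexp : ∀ c : ℝ, ContDiff ℝ ∞ (fun t : ℝ => (Real.exp (c * t) : ℂ)) := fun c =>
    Complex.ofRealCLM.contDiff.comp (Real.contDiff_exp.comp (by fun_prop))
  obtain ⟨P, R, hP, hdP, hPc⟩ := exists_primitive ((hexp (-1 / 2)).mul hψ) hc.mul_left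
  -- The integrating factor e^{-s/2} turns v' - v/2 into a derivative. P is constant near each end
  -- of the line, so subtracting its translate makes v compactly supported.
  set v : ℝ → ℂ := fun s => Real.exp (1 / 2 * s) * (P s - P (s - a)) with hv
  have hvs : ContDiff ℝ ∞ v := (hexp (1 / 2)).mul (hP.sub (hP.comp (by fun_prop)))
  have hvc : HasCompactSupport v := by
    refine HasCompactSupport.intro (isCompact_Icc (a := -(|R| + |a|)) (b := |R| + |a|)) ?_
    intro s hs
    have : P s = P (s - a) := by
      refine hPc _ _ ?_
      rw [mem_Icc, not_and_or, not_le, not_le] at hs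
      have h1 := le_abs_self R
      have h2 := le_abs_self a
      have h3 := neg_abs_le a
      have h4 := abs_nonneg a
      rcases hs with hs | hs
      · right; constructor <;> linarith
      · left; constructor <;> linarith
    simp only [hv, this, sub_self, mul_zero]
  refine ⟨hvc.toSchwartzMap hvs, hvc, fun s => ?_⟩
  change deriv v s - 1 / 2 * v s = _
  have hPd : ∀ s, HasDerivAt P (Real.exp (-1 / 2 * s) * ψ s) s := fun s => by
    have := ((hP.differentiable (by simp)) s).hasDerivAt
    rwa [hdP] at this
  have he : HasDerivAt (fun t : ℝ => (Real.exp (1 / 2 * t) : ℂ))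
      ((Real.exp (1 / 2 * s) * (1 / 2) : ℝ) : ℂ) s := by
    have h := ((hasDerivAt_id s).const_mul (1 / 2 : ℝ)).exp
    simpa using h.ofReal_comp
  have hd : HasDerivAt v _ s := he.mul ((hPd s).sub ((hPd (s - a)).comp_sub_const s a))
  rw [hd.deriv]
  have e1 : (Real.exp (1 / 2 * s) : ℂ) * Real.exp (-1 / 2 * s) = 1 := by
    rw [← Complex.ofReal_mul, ← Real.exp_add]
    ring_nf
    simp
  have e2 : (Real.exp (1 / 2 * s) : ℂ) * Real.exp (-1 / 2 * (s - a)) = Real.exp (a / 2) := by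
    rw [← Complex.ofReal_mul, ← Real.exp_add]
    ring_nf
  simp only [hv, Complex.ofReal_mul]
  push_cast at e1 e2 ⊢
  linear_combination ψ s * e1 - ψ (s - a) * e2

/-- The obstruction to solving v' - v/2 = ψ with compact support is the integral of e^{-s/2} ψ. The
translate e^{a/2} ψ(· - a) cancels it, at a cost of L² norm e^{a/2} ‖ψ‖, which tends to 0 as a → -∞.
-/
theorem exists_schwartz_near (f : Lp ℂ 2 (volume : Measure ℝ)) {ε : ℝ} (hε : 0 < ε) :
    ∃ v : 𝓢(ℝ, ℂ), HasCompactSupport v ∧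
      ‖(derivCLM ℂ ℂ v - (1 / 2 : ℂ) • v).toLp 2 volume - f‖ ≤ ε := by
  obtain ⟨ψ, hc, hψ, hψf⟩ := MemLp.exist_eLpNorm_sub_le (by simp) one_le_two (Lp.memLp f)
    (half_pos hε)
  set Ψ : 𝓢(ℝ, ℂ) := hc.toSchwartzMap hψ with hΨ
  have h1 : ‖Ψ.toLp 2 volume - f‖ ≤ ε / 2 := by
    rw [norm_sub_rev, Lp.norm_def]
    refine ENNReal.toReal_le_of_le_ofReal (half_pos hε).le (le_trans (le_of_eq ?_) hψf)
    refine eLpNorm_congr_ae ?_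
    filter_upwards [Lp.coeFn_sub f (Ψ.toLp 2 volume), Ψ.coeFn_toLp 2 volume] with x h1 h2
    rw [h1, Pi.sub_apply, h2]
    rfl
  obtain ⟨a, ha⟩ : ∃ a : ℝ, Real.exp (a / 2) * ‖Ψ.toLp 2 volume‖ ≤ ε / 2 := by
    have ht : Filter.Tendsto (fun a : ℝ => Real.exp (a / 2) * ‖Ψ.toLp 2 volume‖) Filter.atBot (𝓝 0) := by
      simpa using (Real.tendsto_exp_atBot.comp
        (Filter.tendsto_id.atBot_div_const two_pos)).mul_const ‖Ψ.toLp 2 volume‖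
    exact (ht.eventually_le_const (half_pos hε)).exists
  obtain ⟨v, hvc, hv⟩ := exists_solution hψ hc a
  refine ⟨v, hvc, ?_⟩
  have h2 : ‖(derivCLM ℂ ℂ v - (1 / 2 : ℂ) • v).toLp 2 volume - Ψ.toLp 2 volume‖ ≤ ε / 2 := by
    refine le_trans (le_of_eq ?_) ha
    have hae : ((derivCLM ℂ ℂ v - (1 / 2 : ℂ) • v).toLp 2 volume - Ψ.toLp 2 volume :
        Lp ℂ 2 (volume : Measure ℝ)) =ᵐ[volume]
        (-(Real.exp (a / 2)) : ℂ) • (ψ ∘ fun s => s - a) := by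
      filter_upwards [Lp.coeFn_sub ((derivCLM ℂ ℂ v - (1 / 2 : ℂ) • v).toLp 2 volume)
        (Ψ.toLp 2 volume), Ψ.coeFn_toLp 2 volume,
        (derivCLM ℂ ℂ v - (1 / 2 : ℂ) • v).coeFn_toLp 2 volume] with x e1 e2 e3
      rw [e1, Pi.sub_apply, e2, e3]
      have e4 := hv x
      have e5 : Ψ x = ψ x := rfl
      simp only [sub_apply, smul_apply, derivCLM_apply, smul_eq_mul, e5, e4, Pi.smul_apply,
        Function.comp_apply]
      ring
    have hae2 : (Ψ.toLp 2 volume : Lp ℂ 2 (volume : Measure ℝ)) =ᵐ[volume] ψ :=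
      Ψ.coeFn_toLp 2 volume
    rw [Lp.norm_def, eLpNorm_congr_ae hae, eLpNorm_const_smul, Lp.norm_def, eLpNorm_congr_ae hae2,
      eLpNorm_comp_measurePreserving hψ.continuous.aestronglyMeasurable
        (measurePreserving_sub_right volume a), ENNReal.toReal_mul]
    simp [Complex.norm_exp]
  calc _ ≤ ‖(derivCLM ℂ ℂ v - (1 / 2 : ℂ) • v).toLp 2 volume - Ψ.toLp 2 volume‖ + ‖Ψ.toLp 2 volume - f‖ :=
        norm_sub_le_norm_sub_add_norm_sub _ _ _
    _ ≤ ε := by linarith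

theorem fourier_toLp_deriv (v : 𝓢(ℝ, ℂ)) :
    (Lp.fourierTransformₗᵢ ℝ ℂ ((derivCLM ℂ ℂ v).toLp 2) : ℝ → ℂ) =ᵐ[volume]
      fun s => 2 * Real.pi * Complex.I * s * Lp.fourierTransformₗᵢ ℝ ℂ (v.toLp 2) s := by
  have h : ∀ w : 𝓢(ℝ, ℂ), Lp.fourierTransformₗᵢ ℝ ℂ (w.toLp 2) = (𝓕 w).toLp 2 :=
    SchwartzMap.toLp_fourier_eq
  rw [h, h]
  filter_upwards [(𝓕 (derivCLM ℂ ℂ v)).coeFn_toLp 2, (𝓕 v).coeFn_toLp 2] with s h1 h2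
  rw [h1, h2, fourier_coe, fourier_coe]
  have h3 : ((derivCLM ℂ ℂ v : 𝓢(ℝ, ℂ)) : ℝ → ℂ) = deriv v := by
    ext; simp
  rw [h3, Real.fourier_deriv v.integrable v.differentiable]
  · rfl
  · rw [← h3]
    exact (derivCLM ℂ ℂ v).integrable

end Line

/-! ### Logarithmic polar coordinates -/

section Polar

theorem MeasurableEmbedding.map_withDensity_comp {α β : Type*} [MeasurableSpace α]
    [MeasurableSpace β] {f : α → β} (hf : MeasurableEmbedding f) (μ : Measure α)
    {g : β → ENNReal} (hg : Measurable g) :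
    (μ.withDensity (g ∘ f)).map f = (μ.map f).withDensity g := by
  ext s hs
  rw [hf.map_apply, withDensity_apply _ (hf.measurable hs), withDensity_apply _ hs,
    Measure.restrict_map hf.measurable hs, MeasureTheory.lintegral_map hg hf.measurable]
  rfl

/-- With r = e^s one has r^n dr = e^{(n+1)s} ds. -/
theorem measurePreserving_expOrderIso (n : ℕ) :
    MeasurePreserving (fun s => Real.expOrderIso s)
      ((volume : Measure ℝ).withDensity fun s => ENNReal.ofReal (Real.exp ((n + 1) * s)))
      (Measure.volumeIoiPow n) := by
  have hm : Measurable fun s => Real.expOrderIso s := Real.expOrderIso.continuous.measurable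
  refine ⟨hm, ?_⟩
  ext A hA
  have himg : (Subtype.val '' A : Set ℝ) = Real.exp '' ((fun s => Real.expOrderIso s) ⁻¹' A) := by
    ext r
    constructor
    · rintro ⟨a, ha, rfl⟩
      refine ⟨Real.expOrderIso.symm a, by simpa using ha, ?_⟩
      rw [← Real.coe_expOrderIso_apply, OrderIso.apply_symm_apply]
    · rintro ⟨s, hs, rfl⟩
      exact ⟨_, hs, Real.coe_expOrderIso_apply s⟩
  rw [Measure.map_apply hm hA, withDensity_apply _ (hm hA), Measure.volumeIoiPow,
    withDensity_apply _ hA, setLIntegral_subtype measurableSet_Ioi A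
      (fun r : ℝ => ENNReal.ofReal (r ^ n)), himg,
    lintegral_image_eq_lintegral_abs_deriv_mul (hm hA)
      (fun s _ => (Real.hasDerivAt_exp s).hasDerivWithinAt) Real.exp_injective.injOn]
  refine lintegral_congr fun s => ?_
  rw [Real.abs_exp, ← ENNReal.ofReal_mul (Real.exp_pos s).le, ← Real.exp_nat_mul, ← Real.exp_add]
  congr 2
  ring

/-- Logarithmic polar coordinates, `(ω, s) ↦ e ^ s ω`. -/
noncomputable def logPolar (N : ℕ) (z : Metric.sphere (0 : EuclideanSpace ℝ (Fin N)) 1 × ℝ) :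
    EuclideanSpace ℝ (Fin N) :=
  Real.exp z.2 • (z.1 : EuclideanSpace ℝ (Fin N))

/-- The radial measure in logarithmic polar coordinates. -/
noncomputable def radialMeasure (N : ℕ) : Measure ℝ :=
  volume.withDensity fun s => ENNReal.ofReal (Real.exp (((N : ℝ) - 2) * s))

instance (N : ℕ) : SigmaFinite (radialMeasure N) := SigmaFinite.withDensity_ofReal _

theorem norm_logPolar {N : ℕ} (z : Metric.sphere (0 : EuclideanSpace ℝ (Fin N)) 1 × ℝ) :
    ‖logPolar N z‖ = Real.exp z.2 := by
  simp [logPolar, norm_smul]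

theorem logPolar_eq (N : ℕ) : logPolar N = Subtype.val ∘
    (homeomorphUnitSphereProd (EuclideanSpace ℝ (Fin N))).symm ∘
      Prod.map id fun s => Real.expOrderIso s := by
  ext z : 1
  simp [logPolar]

theorem measurableEmbedding_logPolar (N : ℕ) : MeasurableEmbedding (logPolar N) := by
  rw [logPolar_eq]
  refine (MeasurableEmbedding.subtype_coe (measurableSet_singleton _).compl).comp
    ((Homeomorph.measurableEmbedding _).comp ?_)
  exact ((Homeomorph.refl _).prodCongr Real.expOrderIso.toHomeomorph).measurableEmbedding

theorem measurePreserving_logPolar_volume {N : ℕ} (hN : 1 ≤ N) :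
    MeasurePreserving (logPolar N)
      ((volume : Measure (EuclideanSpace ℝ (Fin N))).toSphere.prod
        (volume.withDensity fun s => ENNReal.ofReal (Real.exp (N * s)))) volume := by
  have : Nonempty (Fin N) := ⟨⟨0, hN⟩⟩
  have h1 := measurePreserving_expOrderIso (N - 1)
  have hc : ((N - 1 : ℕ) : ℝ) + 1 = N := by
    rw [Nat.cast_sub hN]; simp
  rw [hc] at h1
  have : SigmaFinite (volume.withDensity fun s : ℝ => ENNReal.ofReal (Real.exp (N * s))) :=
    SigmaFinite.withDensity_ofReal _
  have h2 := (MeasurePreserving.id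
    (volume : Measure (EuclideanSpace ℝ (Fin N))).toSphere).prod h1
  have h3 := (volume : Measure (EuclideanSpace ℝ (Fin N))).measurePreserving_homeomorphUnitSphereProd
  rw [finrank_euclideanSpace_fin] at h3
  have h4 : MeasurePreserving (Subtype.val : ({0}ᶜ : Set (EuclideanSpace ℝ (Fin N))) → _)
      ((volume : Measure (EuclideanSpace ℝ (Fin N))).comap (↑)) volume := by
    refine ⟨measurable_subtype_coe, ?_⟩
    rw [map_comap_subtype_coe (measurableSet_singleton _).compl, restrict_compl_singleton]
  have h5 := h3.symm (homeomorphUnitSphereProd (EuclideanSpace ℝ (Fin N))).toMeasurableEquiv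
  rw [logPolar_eq]
  exact h4.comp (h5.comp h2)

/-- The weight |x|⁻² = e^{-2s} turns the density e^{Ns} of Lebesgue measure into e^{(N-2)s}. -/
theorem measurePreserving_logPolar {N : ℕ} (hN : 1 ≤ N) :
    MeasurePreserving (logPolar N)
      ((volume : Measure (EuclideanSpace ℝ (Fin N))).toSphere.prod (radialMeasure N))
      (weightedMeasure N) := by
  refine ⟨(measurableEmbedding_logPolar N).measurable, ?_⟩
  rw [weightedMeasure]
  conv_rhs => rw [← (measurePreserving_logPolar_volume hN).map_eq]
  rw [← (measurableEmbedding_logPolar N).map_withDensity_comp _ (by fun_prop)]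
  congr 1
  have hr : radialMeasure N = (volume.withDensity fun s : ℝ =>
      ENNReal.ofReal (Real.exp (N * s))).withDensity fun s =>
        ENNReal.ofReal ((Real.exp s ^ 2)⁻¹) := by
    rw [radialMeasure, ← withDensity_mul _ (by fun_prop) (by fun_prop)]
    congr 1
    ext s
    rw [Pi.mul_apply, ← ENNReal.ofReal_mul (Real.exp_pos _).le, ← Real.exp_nat_mul,
      ← Real.exp_neg, ← Real.exp_add]
    congr 2
    push_cast
    ring
  have : SigmaFinite (volume.withDensity fun s : ℝ => ENNReal.ofReal (Real.exp (N * s))) :=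
    SigmaFinite.withDensity_ofReal _
  rw [hr, prod_withDensity_right (by fun_prop)]
  congr 1
  ext z
  simp [norm_logPolar]

/-- Needed for `logLift` to be well defined on classes modulo null sets. -/
theorem quasiMeasurePreserving_log_norm {N : ℕ} (hN : 1 ≤ N) :
    Measure.QuasiMeasurePreserving (fun x : EuclideanSpace ℝ (Fin N) => Real.log ‖x‖)
      (weightedMeasure N) volume := by
  have hm : Measurable fun x : EuclideanSpace ℝ (Fin N) => Real.log ‖x‖ := by fun_prop
  refine ⟨hm, Measure.AbsolutelyContinuous.mk fun A hA h0 => ?_⟩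
  rw [Measure.map_apply hm hA, ← (measurePreserving_logPolar hN).map_eq,
    (measurableEmbedding_logPolar N).map_apply]
  have hpre : logPolar N ⁻¹' ((fun x => Real.log ‖x‖) ⁻¹' A) = univ ×ˢ A := by
    ext z
    simp [norm_logPolar]
  rw [hpre, Measure.prod_prod, radialMeasure, withDensity_absolutelyContinuous _ _ h0, mul_zero]

/-- The function `r ω ↦ p(ω) r ^ {-(N - 2) / 2} v(log r)`. -/
noncomputable def logLift {N : ℕ} (p : MvPolynomial (Fin N) ℂ) (v : ℝ → ℂ) :
    EuclideanSpace ℝ (Fin N) → ℂ :=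
  fun x => MvPolynomial.eval (fun j => ((x j / ‖x‖ : ℝ) : ℂ)) p *
    (Real.exp (-(((N : ℝ) - 2) / 2 * Real.log ‖x‖)) * v (Real.log ‖x‖))

/-- The restriction of a polynomial to the sphere. -/
noncomputable def sphereEval {N : ℕ} (p : MvPolynomial (Fin N) ℂ)
    (y : Metric.sphere (0 : EuclideanSpace ℝ (Fin N)) 1) : ℂ :=
  MvPolynomial.eval (fun j => (((y : EuclideanSpace ℝ (Fin N)) j : ℝ) : ℂ)) p

theorem continuous_sphereEval {N : ℕ} (p : MvPolynomial (Fin N) ℂ) :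
    Continuous (sphereEval p) :=
  (MvPolynomial.continuous_eval p).comp (by fun_prop)

theorem logLift_logPolar {N : ℕ} (p : MvPolynomial (Fin N) ℂ) (v : ℝ → ℂ)
    (z : Metric.sphere (0 : EuclideanSpace ℝ (Fin N)) 1 × ℝ) :
    logLift p v (logPolar N z) =
      sphereEval p z.1 * (Real.exp (-(((N : ℝ) - 2) / 2 * z.2)) * v z.2) := by
  rw [logLift, norm_logPolar, Real.log_exp, sphereEval]
  congr 3
  ext j
  have h : logPolar N z j = Real.exp z.2 * (z.1 : EuclideanSpace ℝ (Fin N)) j := rfl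
  rw [h, mul_div_cancel_left₀ _ (Real.exp_ne_zero _)]

theorem logLift_congr {N : ℕ} (hN : 1 ≤ N) (p : MvPolynomial (Fin N) ℂ) {v w : ℝ → ℂ}
    (h : v =ᵐ[volume] w) : logLift p v =ᵐ[weightedMeasure N] logLift p w := by
  filter_upwards [(quasiMeasurePreserving_log_norm hN).ae_eq_comp h] with x hx
  simp only [Function.comp_apply] at hx
  rw [logLift, logLift, hx]

theorem memLp_radial {N : ℕ} {v : ℝ → ℂ} (hv : MemLp v 2 volume) :
    MemLp (fun s => (Real.exp (-(((N : ℝ) - 2) / 2 * s)) : ℂ) * v s) 2 (radialMeasure N) := by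
  have hm : AEStronglyMeasurable (fun s => (Real.exp (-(((N : ℝ) - 2) / 2 * s)) : ℂ) * v s)
      (radialMeasure N) := by
    refine AEStronglyMeasurable.mul (by fun_prop) ?_
    exact hv.1.mono_ac (withDensity_absolutelyContinuous _ _)
  rw [memLp_two_iff_integrable_sq_norm hm, radialMeasure,
    integrable_withDensity_iff_integrable_smul' (by fun_prop) (by simp)]
  refine ((memLp_two_iff_integrable_sq_norm hv.1).1 hv).congr (Filter.Eventually.of_forall ?_)
  intro s
  simp only
  rw [ENNReal.toReal_ofReal (Real.exp_pos _).le, norm_mul, Complex.norm_real, Real.norm_eq_abs,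
    Real.abs_exp, mul_pow, ← Real.exp_nat_mul, smul_eq_mul, ← mul_assoc, ← Real.exp_add]
  have : ((N : ℝ) - 2) * s + (2 : ℕ) * -(((N : ℝ) - 2) / 2 * s) = 0 := by push_cast; ring
  rw [this, Real.exp_zero, one_mul]

theorem memLp_logLift {N : ℕ} (hN : 1 ≤ N) (p : MvPolynomial (Fin N) ℂ) {v : ℝ → ℂ}
    (hv : MemLp v 2 volume) : MemLp (logLift p v) 2 (weightedMeasure N) := by
  rw [← (measurePreserving_logPolar hN).map_eq,
    (measurableEmbedding_logPolar N).memLp_map_measure_iff]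
  have hr := memLp_radial (N := N) hv
  have hm := (continuous_sphereEval p).aestronglyMeasurable.comp_fst
    (μ := (volume : Measure (EuclideanSpace ℝ (Fin N))).toSphere) (ν := radialMeasure N)
    |>.mul hr.1.comp_snd
  have he : logLift p v ∘ logPolar N = fun z => sphereEval p z.1 *
      (Real.exp (-(((N : ℝ) - 2) / 2 * z.2)) * v z.2) := funext (logLift_logPolar p v)
  rw [he]
  refine (memLp_two_iff_integrable_sq_norm hm).2 ?_
  have h1 : Integrable (fun y => ‖sphereEval p y‖ ^ 2)
      (volume : Measure (EuclideanSpace ℝ (Fin N))).toSphere :=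
    ((continuous_sphereEval p).norm.pow 2).integrable_of_hasCompactSupport
      (HasCompactSupport.of_compactSpace _)
  refine (h1.mul_prod ((memLp_two_iff_integrable_sq_norm hr.1).1 hr)).congr
    (Filter.Eventually.of_forall fun z => ?_)
  simp only [Pi.mul_apply, norm_mul, mul_pow]

/-- The operator `v ↦ (r ω ↦ p(ω) r ^ {-(N - 2) / 2} v(log r))` from `L²(ℝ)`. -/
noncomputable def logLiftL2 {N : ℕ} (hN : 1 ≤ N) (p : MvPolynomial (Fin N) ℂ) :
    Lp ℂ 2 (volume : Measure ℝ) →ₗ[ℂ] WeightedL2 N where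
  toFun v := (memLp_logLift hN p (Lp.memLp v)).toLp _
  map_add' v w := by
    rw [← MemLp.toLp_add]
    refine MemLp.toLp_congr _ _ ((logLift_congr hN p (Lp.coeFn_add v w)).trans
      (Filter.Eventually.of_forall fun x => ?_))
    simp only [logLift, Pi.add_apply]
    ring
  map_smul' c v := by
    rw [RingHom.id_apply, ← MemLp.toLp_const_smul]
    refine MemLp.toLp_congr _ _ ((logLift_congr hN p (Lp.coeFn_smul c v)).trans
      (Filter.Eventually.of_forall fun x => ?_))
    simp only [logLift, Pi.smul_apply, smul_eq_mul]
    ring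

theorem logLiftL2_coe {N : ℕ} (hN : 1 ≤ N) (p : MvPolynomial (Fin N) ℂ)
    (v : Lp ℂ 2 (volume : Measure ℝ)) :
    (logLiftL2 hN p v : EuclideanSpace ℝ (Fin N) → ℂ) =ᵐ[weightedMeasure N] logLift p v :=
  MemLp.coeFn_toLp (memLp_logLift hN p (Lp.memLp v))

/-- Fubini in logarithmic polar coordinates: the two factors e^{-(N-2)s/2} cancel the density
e^{(N-2)s}. -/
theorem inner_logLiftL2 {N : ℕ} (hN : 1 ≤ N) (p q : MvPolynomial (Fin N) ℂ)
    (v w : Lp ℂ 2 (volume : Measure ℝ)) :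
    inner ℂ (logLiftL2 hN p v) (logLiftL2 hN q w) =
      (∫ y, inner ℂ (sphereEval p y) (sphereEval q y)
        ∂(volume : Measure (EuclideanSpace ℝ (Fin N))).toSphere) * inner ℂ v w := by
  have h1 : inner ℂ (logLiftL2 hN p v) (logLiftL2 hN q w) =
      ∫ x, inner ℂ (logLift p v x) (logLift q w x) ∂weightedMeasure N := by
    rw [L2.inner_def]
    refine integral_congr_ae ?_
    filter_upwards [logLiftL2_coe hN p v, logLiftL2_coe hN q w] with x e1 e2
    rw [e1, e2]
  rw [h1, ← (measurePreserving_logPolar hN).integral_comp (measurableEmbedding_logPolar N)]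
  have h2 : ∀ z : Metric.sphere (0 : EuclideanSpace ℝ (Fin N)) 1 × ℝ,
      inner ℂ (logLift p v (logPolar N z)) (logLift q w (logPolar N z)) =
        inner ℂ (sphereEval p z.1) (sphereEval q z.1) *
          ((Real.exp (-(((N : ℝ) - 2) * z.2)) : ℂ) * inner ℂ (v z.2) (w z.2)) := by
    intro z
    have he : Real.exp (-(((N : ℝ) - 2) * z.2)) =
        Real.exp (-(((N : ℝ) - 2) / 2 * z.2)) * Real.exp (-(((N : ℝ) - 2) / 2 * z.2)) := by
      rw [← Real.exp_add]
      ring_nf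
    rw [logLift_logPolar, logLift_logPolar, he, Complex.ofReal_mul]
    simp only [RCLike.inner_apply, map_mul, Complex.conj_ofReal]
    ring
  simp_rw [h2]
  rw [integral_prod_mul (fun y => inner ℂ (sphereEval p y) (sphereEval q y))
    (fun s : ℝ => (Real.exp (-(((N : ℝ) - 2) * s)) : ℂ) * inner ℂ (v s) (w s)), L2.inner_def,
    radialMeasure, integral_withDensity_eq_integral_toReal_smul (by fun_prop) (by simp)]
  congr 1
  refine integral_congr_ae (Filter.Eventually.of_forall fun s => ?_)
  simp only
  rw [ENNReal.toReal_ofReal (Real.exp_pos _).le, Complex.real_smul, ← mul_assoc,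
    ← Complex.ofReal_mul, ← Real.exp_add, add_neg_cancel]
  simp

end Polar

/-! ### The core in logarithmic coordinates -/

section Core

open SchwartzMap

/-- `f` is `v` in logarithmic coordinates, up to the factor `r ^ {-(N - 2) / 2}`. -/
def LogRelated (N : ℕ) (f v : ℝ → ℂ) : Prop :=
  ∀ r, 0 < r → f r = Real.exp (-(((N : ℝ) - 2) / 2 * Real.log r)) * v (Real.log r)

theorem LogRelated.polarTensor_eq {N : ℕ} {f v : ℝ → ℂ} (h : LogRelated N f v)
    (p : MvPolynomial (Fin N) ℂ) {x : EuclideanSpace ℝ (Fin N)} (hx : x ≠ 0) :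
    polarTensor p f x = logLift p v x := by
  rw [polarTensor, logLift, h _ (norm_pos_iff.2 hx)]

theorem toL2_eq_logLiftL2 {N : ℕ} (hN : 1 ≤ N) (p : MvPolynomial (Fin N) ℂ)
    {F : puncturedTest N} {v : 𝓢(ℝ, ℂ)} (h : ∀ x, x ≠ 0 → F.1 x = logLift p v x) :
    puncturedTest.toL2 N F = logLiftL2 hN p (v.toLp 2 volume) := by
  refine Lp.ext ?_
  filter_upwards [ae_ne_zero_weightedMeasure hN, (puncturedTest_memLp F.2).coeFn_toLp,
    logLiftL2_coe hN p (v.toLp 2 volume), logLift_congr hN p (v.coeFn_toLp 2 volume)]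
    with x hx h1 h2 h3
  rw [h2, h3, ← h x hx]
  exact h1

/-- ∑ x_j ∂_j is the derivative of t ↦ F(tx) at t = 1, and the angular factor is constant along the
ray. -/
theorem eulerOperator_polarTensor {N : ℕ} (p : MvPolynomial (Fin N) ℂ) {f : ℝ → ℂ}
    (hf : IsRadialTest f) {x : EuclideanSpace ℝ (Fin N)} (hx : x ≠ 0) :
    eulerOperator N (polarTensor p f) x =
      MvPolynomial.eval (fun j => ((x j / ‖x‖ : ℝ) : ℂ)) p *
        (2 * ‖x‖ * deriv f ‖x‖ + ((N : ℂ) - 2) * f ‖x‖) := by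
  have hn : 0 < ‖x‖ := norm_pos_iff.2 hx
  have h1 : ∑ j, (x j : ℂ) * fderiv ℝ (polarTensor p f) x (EuclideanSpace.single j 1) =
      fderiv ℝ (polarTensor p f) x x := by
    have hxs : x = ∑ j, x j • EuclideanSpace.single j (1 : ℝ) := by
      ext i
      simp [Finset.sum_apply, Pi.single_apply]
    refine Eq.trans ?_ (congrArg (fderiv ℝ (polarTensor p f) x) hxs).symm
    simp only [map_sum, map_smul, Complex.real_smul]
  have h2 : HasDerivAt (fun t : ℝ => polarTensor p f (t • x)) (fderiv ℝ (polarTensor p f) x x) 1 := by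
    have hF : HasFDerivAt (polarTensor p f) (fderiv ℝ (polarTensor p f) x) ((1 : ℝ) • x) := by
      rw [one_smul]
      exact ((polarTensor_mem p hf).1.differentiable (by simp) x).hasFDerivAt
    have hl : HasDerivAt (fun t : ℝ => t • x) x 1 := by
      simpa using (hasDerivAt_id (1 : ℝ)).smul_const x
    exact hF.comp_hasDerivAt 1 hl
  have h3 : HasDerivAt (fun t : ℝ => MvPolynomial.eval (fun j => ((x j / ‖x‖ : ℝ) : ℂ)) p *
      f (t * ‖x‖)) (MvPolynomial.eval (fun j => ((x j / ‖x‖ : ℝ) : ℂ)) p *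
        (‖x‖ • deriv f ‖x‖)) 1 := by
    have hd : HasDerivAt f (deriv f ‖x‖) (1 * ‖x‖) := by
      rw [one_mul]
      exact (hf.1.differentiable (by simp) _).hasDerivAt
    have hl : HasDerivAt (fun t : ℝ => t * ‖x‖) ‖x‖ 1 := by
      simpa using (hasDerivAt_id (1 : ℝ)).mul_const ‖x‖
    exact (hd.scomp 1 hl).const_mul _
  have h4 : (fun t : ℝ => polarTensor p f (t • x)) =ᶠ[𝓝 1] fun t : ℝ =>
      MvPolynomial.eval (fun j => ((x j / ‖x‖ : ℝ) : ℂ)) p * f (t * ‖x‖) := by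
    filter_upwards [lt_mem_nhds (zero_lt_one' ℝ)] with t ht
    rw [polarTensor, norm_smul, Real.norm_eq_abs, abs_of_pos ht]
    congr 3
    ext j
    rw [PiLp.smul_apply, smul_eq_mul, mul_div_mul_left _ _ ht.ne']
  have h5 := h2.unique (h3.congr_of_eventuallyEq h4)
  rw [eulerOperator, h1, h5, polarTensor, Complex.real_smul]
  ring

/-- Since r d/dr = d/ds, differentiating the prefactor contributes -(N-2)/2; doubled, it cancels N -
2. -/
theorem LogRelated.eulerOperator_eq {N : ℕ} {f : ℝ → ℂ} {v : 𝓢(ℝ, ℂ)} (h : LogRelated N f v)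
    (hf : IsRadialTest f) (p : MvPolynomial (Fin N) ℂ) {x : EuclideanSpace ℝ (Fin N)}
    (hx : x ≠ 0) :
    eulerOperator N (polarTensor p f) x = logLift p ((2 : ℂ) • derivCLM ℂ ℂ v : 𝓢(ℝ, ℂ)) x := by
  have hn : 0 < ‖x‖ := norm_pos_iff.2 hx
  have hlog := Real.hasDerivAt_log hn.ne'
  have hd : HasDerivAt f (deriv f ‖x‖) ‖x‖ := (hf.1.differentiable (by simp) _).hasDerivAt
  have hv : HasDerivAt v (deriv v (Real.log ‖x‖)) (Real.log ‖x‖) :=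
    (v.differentiable _).hasDerivAt
  have he : HasDerivAt (fun r => (Real.exp (-(((N : ℝ) - 2) / 2 * Real.log r)) : ℂ))
      ((Real.exp (-(((N : ℝ) - 2) / 2 * Real.log ‖x‖)) * -(((N : ℝ) - 2) / 2 * ‖x‖⁻¹) : ℝ) : ℂ)
      ‖x‖ := ((hlog.const_mul (((N : ℝ) - 2) / 2)).neg.exp).ofReal_comp
  have h1 := he.mul (hv.scomp ‖x‖ hlog)
  have h2 := h1.congr_of_eventuallyEq (f₁ := f) (by
    filter_upwards [lt_mem_nhds hn] with r hr
    rw [h r hr]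
    rfl)
  rw [eulerOperator_polarTensor p hf hx, hd.unique h2, h _ hn, logLift]
  congr 1
  have hn' : (‖x‖ : ℂ) ≠ 0 := by exact_mod_cast hn.ne'
  simp only [smul_apply, derivCLM_apply, smul_eq_mul, Function.comp_apply, Complex.real_smul]
  push_cast
  field_simp
  ring

theorem IsRadialTest.exists_logRelated {f : ℝ → ℂ} (hf : IsRadialTest f) (N : ℕ) :
    ∃ v : 𝓢(ℝ, ℂ), HasCompactSupport v ∧ LogRelated N f v := by
  obtain ⟨h1, h2, h3⟩ := hf
  set v : ℝ → ℂ := fun s => Real.exp (((N : ℝ) - 2) / 2 * s) * f (Real.exp s) with hv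
  have hvs : ContDiff ℝ ∞ v :=
    (Complex.ofRealCLM.contDiff.comp (Real.contDiff_exp.comp (by fun_prop))).mul
      (h1.comp Real.contDiff_exp)
  have hvc : HasCompactSupport v := by
    have hc : IsCompact (Real.log '' tsupport f) := by
      refine h2.image_of_continuousOn (Real.continuousOn_log.mono fun x hx => ?_)
      exact ne_of_gt (h3 hx)
    refine HasCompactSupport.intro hc fun s hs => ?_
    have : Real.exp s ∉ tsupport f := fun h => hs ⟨_, h, Real.log_exp s⟩
    simp only [hv, image_eq_zero_of_notMem_tsupport this, mul_zero]
  refine ⟨hvc.toSchwartzMap hvs, hvc, fun r hr => ?_⟩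
  change _ = _ * v (Real.log r)
  simp only [hv]
  rw [Real.exp_log hr, ← mul_assoc, ← Complex.ofReal_mul, ← Real.exp_add]
  simp

/-- The exponential carries the support of v to a compact subset of (0, ∞), so extension by zero
remains smooth. -/
theorem exists_radialTest_logRelated {v : ℝ → ℂ} (hv : ContDiff ℝ ∞ v) (hc : HasCompactSupport v)
    (N : ℕ) : ∃ f, IsRadialTest f ∧ LogRelated N f v := by
  set g : ℝ → ℂ := fun r => Real.exp (-(((N : ℝ) - 2) / 2 * Real.log r)) * v (Real.log r) with hg
  have hK : IsCompact (Real.exp '' tsupport v) := hc.image Real.continuous_exp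
  have hK0 : Real.exp '' tsupport v ⊆ Ioi 0 := by
    rintro _ ⟨s, _, rfl⟩
    exact Real.exp_pos s
  have hsupp : Function.support ((Ioi 0).indicator g) ⊆ Real.exp '' tsupport v := by
    intro r hr
    have hr0 : r ∈ Ioi (0 : ℝ) := mem_of_indicator_ne_zero hr
    rw [Function.mem_support, indicator_of_mem hr0] at hr
    refine ⟨Real.log r, subset_tsupport _ fun h => hr ?_, Real.exp_log hr0⟩
    simp only [hg, h, mul_zero]
  have hts : tsupport ((Ioi 0).indicator g) ⊆ Real.exp '' tsupport v :=
    closure_minimal hsupp hK.isClosed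
  refine ⟨(Ioi 0).indicator g, ⟨?_, HasCompactSupport.of_support_subset_isCompact hK hsupp,
    hts.trans hK0⟩, fun r hr => indicator_of_mem (show r ∈ Ioi 0 from hr) g⟩
  rw [contDiff_iff_contDiffAt]
  intro r
  by_cases hr : 0 < r
  · have hgr : ContDiffAt ℝ ∞ g r := by
      have hl : ContDiffAt ℝ ∞ Real.log r := Real.contDiffAt_log.2 hr.ne'
      refine ContDiffAt.mul ?_ (hv.contDiffAt.comp r hl)
      exact Complex.ofRealCLM.contDiff.contDiffAt.comp r
        (Real.contDiff_exp.contDiffAt.comp r (contDiffAt_const.mul hl).neg)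
    refine hgr.congr_of_eventuallyEq ?_
    filter_upwards [lt_mem_nhds hr] with t ht
    exact indicator_of_mem (show t ∈ Ioi 0 from ht) g
  · have h0 : (Ioi 0).indicator g =ᶠ[𝓝 r] 0 :=
      notMem_tsupport_iff_eventuallyEq.1 fun h => hr (hK0 (hts h))
    exact (contDiffAt_const (c := (0 : ℂ))).congr_of_eventuallyEq h0

end Core

/-! ### The spectral representation -/

section Representation

open SchwartzMap

/-- A unitary map of `L` acts on a Hilbert space spanned by copies of `L` in constant relative
position. -/
theorem exists_linearIsometryEquiv_of_inner_eq {ι L H : Type*} [NormedAddCommGroup L]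
    [InnerProductSpace ℂ L] [NormedAddCommGroup H] [InnerProductSpace ℂ H] [CompleteSpace H]
    (J : ι → L →ₗ[ℂ] H) (c : ι → ι → ℂ)
    (hJ : ∀ a b v w, inner ℂ (J a v) (J b w) = c a b * inner ℂ v w)
    (hd : DenseRange (Finsupp.lsum ℂ J)) (U : L ≃ₗᵢ[ℂ] L) :
    ∃ V : H ≃ₗᵢ[ℂ] H, ∀ a v, V (J a v) = J a (U v) := by
  classical
  -- The norm of ∑ J_a(x_a) depends only on c and the inner products of the x_a, which U preserves.
  -- In particular the map is well defined even if the J_a have linear relations.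
  have hnorm : ∀ x : ι →₀ L, ‖Finsupp.lsum ℂ J (Finsupp.mapRange.linearEquiv U.toLinearEquiv x)‖ =
      ‖Finsupp.lsum ℂ J x‖ := by
    intro x
    have key : ∀ W : L ≃ₗᵢ[ℂ] L, inner ℂ
        (Finsupp.lsum ℂ J (Finsupp.mapRange.linearEquiv W.toLinearEquiv x))
        (Finsupp.lsum ℂ J (Finsupp.mapRange.linearEquiv W.toLinearEquiv x)) =
        ∑ a ∈ x.support, ∑ b ∈ x.support, c a b * inner ℂ (x a) (x b) := by
      intro W
      have h1 : Finsupp.lsum ℂ J (Finsupp.mapRange.linearEquiv W.toLinearEquiv x) =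
          ∑ a ∈ x.support, J a (W (x a)) := by
        rw [Finsupp.mapRange.linearEquiv_apply, Finsupp.lsum_apply,
          Finsupp.sum_mapRange_index (fun a => map_zero (J a))]
        rfl
      rw [h1, sum_inner]
      refine Finset.sum_congr rfl fun a _ => ?_
      rw [inner_sum]
      refine Finset.sum_congr rfl fun b _ => ?_
      rw [hJ, W.inner_map_map]
    have h2 := (key U).trans (key (LinearIsometryEquiv.refl ℂ L)).symm
    have h3 : Finsupp.mapRange.linearEquiv (LinearIsometryEquiv.refl ℂ L).toLinearEquiv x = x := by
      ext a
      simp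
    rw [h3, inner_self_eq_norm_sq_to_K, inner_self_eq_norm_sq_to_K] at h2
    have h4 : ‖Finsupp.lsum ℂ J (Finsupp.mapRange.linearEquiv U.toLinearEquiv x)‖ ^ 2 =
      ‖Finsupp.lsum ℂ J x‖ ^ 2 := by exact_mod_cast h2
    exact (sq_eq_sq₀ (norm_nonneg _) (norm_nonneg _)).1 h4
  refine ⟨(Finsupp.mapRange.linearEquiv U.toLinearEquiv).extendOfIsometry _ _ hd hd hnorm,
    fun a v => ?_⟩
  have h := LinearEquiv.extendOfIsometry_eq (Finsupp.mapRange.linearEquiv U.toLinearEquiv)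
    _ _ hd hd hnorm (Finsupp.single a v)
  simpa using h

theorem denseRange_lsum_logLiftL2 {N : ℕ} (hN : 1 ≤ N) :
    DenseRange (Finsupp.lsum ℂ fun p : MvPolynomial (Fin N) ℂ => logLiftL2 hN p) := by
  suffices h : (harmonicCore N).map (puncturedTest.toL2 N) ≤
      LinearMap.range (Finsupp.lsum ℂ fun p : MvPolynomial (Fin N) ℂ => logLiftL2 hN p) from
    (harmonicCore_dense hN).mono h
  rw [harmonicCore, Submodule.map_span_le]
  rintro _ ⟨m, p, f, hf, -, rfl⟩
  obtain ⟨v, -, hfv⟩ := hf.exists_logRelated N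
  refine ⟨Finsupp.single p (v.toLp 2 volume), ?_⟩
  rw [toL2_eq_logLiftL2 hN p (v := v) fun x hx => hfv.polarTensor_eq p hx]
  simp

/-- The unitary map diagonalizing the generator of dilations: the Mellin transform in the radial
variable. -/
theorem exists_mellin {N : ℕ} (hN : 1 ≤ N) : ∃ V : WeightedL2 N ≃ₗᵢ[ℂ] WeightedL2 N,
    ∀ p v, V (logLiftL2 hN p v) = logLiftL2 hN p (Lp.fourierTransformₗᵢ ℝ ℂ v) :=
  exists_linearIsometryEquiv_of_inner_eq (logLiftL2 hN) _ (inner_logLiftL2 hN)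
    (denseRange_lsum_logLiftL2 hN) _

theorem continuous_logLiftL2 {N : ℕ} (hN : 1 ≤ N) (p : MvPolynomial (Fin N) ℂ) :
    Continuous (logLiftL2 hN p) := by
  set c := ∫ y, inner ℂ (sphereEval p y) (sphereEval p y)
        ∂(volume : Measure (EuclideanSpace ℝ (Fin N))).toSphere
  refine AddMonoidHomClass.continuous_of_bound (logLiftL2 hN p) (Real.sqrt ‖c‖) fun v => ?_
  have h := congrArg norm (inner_logLiftL2 hN p p v v)
  rw [norm_mul, inner_self_eq_norm_sq_to_K, inner_self_eq_norm_sq_to_K] at h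
  simp only [norm_pow, RCLike.norm_ofReal, abs_norm] at h
  rw [← Real.sqrt_sq (norm_nonneg (logLiftL2 hN p v)), h, Real.sqrt_mul (norm_nonneg _),
    Real.sqrt_sq (norm_nonneg v)]

/-- The multiplier representing the closure of the Euler operator. -/
noncomputable def logNorm (N : ℕ) (x : EuclideanSpace ℝ (Fin N)) : ℝ :=
  4 * Real.pi * Real.log ‖x‖

theorem measurable_logNorm (N : ℕ) : Measurable (logNorm N) := by
  unfold logNorm
  fun_prop

theorem mem_eulerCoreOperator_graph_iff {N : ℕ} {u w : WeightedL2 N} :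
    (u, w) ∈ (eulerCoreOperator N).graph ↔ ∃ F ∈ harmonicCore N, u = puncturedTest.toL2 N F ∧
      w = (1 / Complex.I) • puncturedTest.toL2 N (puncturedTest.euler N F) := by
  let e := Submodule.equivMapOfInjective (puncturedTest.toL2 N) (puncturedTest.toL2_injective N)
    (harmonicCore N)
  have happ : ∀ F : harmonicCore N, eulerCoreOperator N (e F) =
      (1 / Complex.I) • puncturedTest.toL2 N (puncturedTest.euler N F) := by
    intro F
    change (1 / Complex.I) • puncturedTest.toL2 N (puncturedTest.euler N (e.symm (e F))) = _
    rw [e.symm_apply_apply]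
  rw [LinearPMap.mem_graph_iff]
  constructor
  · rintro ⟨y, hy, hw⟩
    obtain ⟨F, rfl⟩ := e.surjective y
    exact ⟨F, F.2, hy.symm, hw.symm.trans (happ F)⟩
  · rintro ⟨F, hF, rfl, rfl⟩
    exact ⟨e ⟨F, hF⟩, rfl, happ ⟨F, hF⟩⟩

theorem toL2_euler_eq {N : ℕ} (hN : 1 ≤ N) (p : MvPolynomial (Fin N) ℂ) {f : ℝ → ℂ}
    (hf : IsRadialTest f) {v : 𝓢(ℝ, ℂ)} (h : LogRelated N f v) :
    puncturedTest.toL2 N (puncturedTest.euler N ⟨polarTensor p f, polarTensor_mem p hf⟩) =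
      logLiftL2 hN p ((2 : ℂ) • (derivCLM ℂ ℂ v).toLp 2 volume) :=
  toL2_eq_logLiftL2 hN p (v := (2 : ℂ) • derivCLM ℂ ℂ v) fun _ hx => h.eulerOperator_eq hf p hx

/-- The Fourier transform turns (2/i) d/ds into multiplication by (2/i)(2πi s) = 4πs, and under J_p
the variable s is log|x|. -/
theorem mellin_mem_graph {N : ℕ} (hN : 1 ≤ N) {V : WeightedL2 N ≃ₗᵢ[ℂ] WeightedL2 N}
    (hV : ∀ p v, V (logLiftL2 hN p v) = logLiftL2 hN p (Lp.fourierTransformₗᵢ ℝ ℂ v))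
    (p : MvPolynomial (Fin N) ℂ) (v : 𝓢(ℝ, ℂ)) :
    (logLiftL2 hN p (v.toLp 2 volume),
      (1 / Complex.I) • logLiftL2 hN p ((2 : ℂ) • (derivCLM ℂ ℂ v).toLp 2 volume)) ∈
      (conjOperator V (mulOperator (weightedMeasure N) fun x => (logNorm N x : ℂ))).graph := by
  rw [mem_conjOperator_graph_iff, mem_mulOperator_graph_iff, map_smul, hV, hV, map_smul, map_smul,
    smul_smul]
  refine (Lp.coeFn_smul _ _).trans ?_
  filter_upwards [logLiftL2_coe hN p (Lp.fourierTransformₗᵢ ℝ ℂ ((derivCLM ℂ ℂ v).toLp 2 volume)),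
    logLift_congr hN p (fourier_toLp_deriv v),
    logLiftL2_coe hN p (Lp.fourierTransformₗᵢ ℝ ℂ (v.toLp 2 volume))] with x h1 h2 h3
  rw [Pi.smul_apply, h1, h2, h3, logLift, logLift, logNorm, smul_eq_mul]
  push_cast
  field_simp [Complex.I_ne_zero]
  ring

theorem eulerCoreOperator_le {N : ℕ} (hN : 1 ≤ N) {V : WeightedL2 N ≃ₗᵢ[ℂ] WeightedL2 N}
    (hV : ∀ p v, V (logLiftL2 hN p v) = logLiftL2 hN p (Lp.fourierTransformₗᵢ ℝ ℂ v)) :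
    eulerCoreOperator N ≤
      conjOperator V (mulOperator (weightedMeasure N) fun x => (logNorm N x : ℂ)) := by
  refine LinearPMap.le_of_le_graph ?_
  rintro ⟨u, w⟩ huw
  obtain ⟨F, hF, rfl, rfl⟩ := mem_eulerCoreOperator_graph_iff.1 huw
  let G : puncturedTest N →ₗ[ℂ] WeightedL2 N × WeightedL2 N :=
    (puncturedTest.toL2 N).prod
      ((1 / Complex.I) • (puncturedTest.toL2 N ∘ₗ puncturedTest.euler N))
  suffices h : harmonicCore N ≤ (conjOperator V
      (mulOperator (weightedMeasure N) fun x => (logNorm N x : ℂ))).graph.comap G from h hF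
  refine Submodule.span_le.2 ?_
  rintro _ ⟨m, p, f, hf, -, rfl⟩
  obtain ⟨v, -, hfv⟩ := hf.exists_logRelated N
  change (puncturedTest.toL2 N _, (1 / Complex.I) • puncturedTest.toL2 N _) ∈ (conjOperator V
    (mulOperator (weightedMeasure N) fun x => (logNorm N x : ℂ))).graph
  rw [toL2_euler_eq hN p hf hfv, toL2_eq_logLiftL2 hN p (v := v) fun x hx => hfv.polarTensor_eq p hx]
  exact mellin_mem_graph hN hV p v

/-- The range of `T + i` on the core is dense. -/
theorem eulerCoreOperator_add_I_dense {N : ℕ} (hN : 1 ≤ N) :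
    Dense (((eulerCoreOperator N).graph.map
      (LinearMap.snd ℂ (WeightedL2 N) (WeightedL2 N) + Complex.I • LinearMap.fst ℂ _ _) :
        Submodule ℂ (WeightedL2 N)) : Set (WeightedL2 N)) := by
  set D := (eulerCoreOperator N).graph.map
    (LinearMap.snd ℂ (WeightedL2 N) (WeightedL2 N) + Complex.I • LinearMap.fst ℂ _ _) with hD
  suffices h : (harmonicCore N).map (puncturedTest.toL2 N) ≤ D.topologicalClosure by
    have h1 : Dense (closure (D : Set (WeightedL2 N))) := (harmonicCore_dense hN).mono h
    rwa [dense_closure] at h1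
  rw [harmonicCore, Submodule.map_span_le]
  rintro _ ⟨m, p, f, hf, hp, rfl⟩
  obtain ⟨v, -, hfv⟩ := hf.exists_logRelated N
  rw [toL2_eq_logLiftL2 hN p (v := v) fun x hx => hfv.polarTensor_eq p hx]
  have hcl : v.toLp 2 volume ∈ closure {g : Lp ℂ 2 (volume : Measure ℝ) | ∃ w : 𝓢(ℝ, ℂ),
      HasCompactSupport w ∧ g = (derivCLM ℂ ℂ w - (1 / 2 : ℂ) • w).toLp 2 volume} := by
    refine Metric.mem_closure_iff.2 fun ε hε => ?_
    obtain ⟨w, hw, hle⟩ := exists_schwartz_near (v.toLp 2 volume) (half_pos hε)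
    refine ⟨_, ⟨w, hw, rfl⟩, ?_⟩
    rw [dist_comm, dist_eq_norm]
    exact lt_of_le_of_lt hle (half_lt_self hε)
  refine map_mem_closure (continuous_logLiftL2 hN p) hcl ?_
  rintro _ ⟨w, hw, rfl⟩
  obtain ⟨k, hk, hkw⟩ := exists_radialTest_logRelated w.smooth' hw N
  have hgraph : (puncturedTest.toL2 N ⟨polarTensor p k, polarTensor_mem p hk⟩,
      (1 / Complex.I) • puncturedTest.toL2 N
        (puncturedTest.euler N ⟨polarTensor p k, polarTensor_mem p hk⟩)) ∈
      (eulerCoreOperator N).graph :=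
    mem_eulerCoreOperator_graph_iff.2
      ⟨_, Submodule.subset_span ⟨m, p, k, hk, hp, rfl⟩, rfl, rfl⟩
  rw [toL2_euler_eq hN p hk hkw,
    toL2_eq_logLiftL2 hN p (v := w) fun x hx => hkw.polarTensor_eq p hx] at hgraph
  -- The scalar normalizes T + i: (i/2)((2/i) w' + i w) = w' - w/2.
  have hmem := D.smul_mem (Complex.I / 2) (Submodule.mem_map_of_mem hgraph)
  change _ ∈ D
  convert hmem using 1
  have hsub : (derivCLM ℂ ℂ w - (1 / 2 : ℂ) • w).toLp 2 volume =
      (derivCLM ℂ ℂ w).toLp 2 volume - (1 / 2 : ℂ) • w.toLp 2 volume := rfl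
  rw [hsub, map_sub, map_smul, map_smul]
  simp only [LinearMap.add_apply, LinearMap.smul_apply, LinearMap.fst_apply, LinearMap.snd_apply,
    smul_add, smul_smul, sub_eq_add_neg, ← neg_smul]
  congr 1
  · rw [show Complex.I / 2 * (1 / Complex.I * 2) = 1 by field_simp [Complex.I_ne_zero], one_smul]
  · rw [show Complex.I / 2 * Complex.I = -(1 / 2) by
      rw [div_mul_eq_mul_div, Complex.I_mul_I]; norm_num]

/-- A real multiplier is self-adjoint, so ⟨b, a⟩ is real and the cross term 2 Re(i⟨b, a⟩) vanishes.
-/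
theorem norm_add_I_smul_sq {X : Type*} [MeasurableSpace X] {μ : Measure X} {h : X → ℝ}
    (hh : Measurable h) {a b : Lp ℂ 2 μ}
    (hab : (a, b) ∈ (mulOperator μ fun x => (h x : ℂ)).graph) :
    ‖b + Complex.I • a‖ ^ 2 = ‖b‖ ^ 2 + ‖a‖ ^ 2 := by
  have hm : Measurable fun x => (h x : ℂ) := by fun_prop
  have hadj : (a, b) ∈ (mulOperator μ fun x => (h x : ℂ)).adjoint.graph := by
    rw [mulOperator_adjoint hm]
    simpa using hab
  have h1 := (mem_adjoint_graph_iff (mulOperator_dense hm)).1 hadj a b hab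
  have h2 : (inner ℂ b a : ℂ).im = 0 := by
    rw [← Complex.conj_eq_iff_im, inner_conj_symm, h1]
  rw [@norm_add_sq ℂ, inner_smul_right, norm_smul, Complex.norm_I]
  simp [h2]

/-- The map (u, w) ↦ w + iu controls both coordinates on the graph of S. Approximating w + iu by
values from the core therefore approximates the pair itself. -/
theorem eulerClosure_eq {N : ℕ} (hN : 1 ≤ N) {V : WeightedL2 N ≃ₗᵢ[ℂ] WeightedL2 N}
    (hV : ∀ p v, V (logLiftL2 hN p v) = logLiftL2 hN p (Lp.fourierTransformₗᵢ ℝ ℂ v)) :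
    eulerClosure N =
      conjOperator V (mulOperator (weightedMeasure N) fun x => (logNorm N x : ℂ)) := by
  have hm : Measurable fun x => (logNorm N x : ℂ) := by
    have := measurable_logNorm N
    fun_prop
  set S := conjOperator V (mulOperator (weightedMeasure N) fun x => (logNorm N x : ℂ)) with hS
  have hle : eulerCoreOperator N ≤ S := eulerCoreOperator_le hN hV
  have hSc : S.IsClosed := conjOperator_isClosed (mulOperator_isClosed hm)
  have hcl : (eulerCoreOperator N).IsClosable := hSc.isClosable.leIsClosable hle
  refine LinearPMap.eq_of_eq_graph ?_
  rw [eulerClosure, ← hcl.graph_closure_eq_closure_graph]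
  refine le_antisymm ?_ ?_
  · exact Submodule.topologicalClosure_minimal _ (LinearPMap.le_graph_of_le hle) hSc
  rintro ⟨u, w⟩ huw
  rw [← SetLike.mem_coe, Submodule.topologicalClosure_coe, Metric.mem_closure_iff]
  intro ε hε
  obtain ⟨_, hdist, ⟨⟨u', w'⟩, hc, rfl⟩⟩ :=
    Metric.dense_iff.1 (eulerCoreOperator_add_I_dense hN) (w + Complex.I • u) ε hε
  refine ⟨(u', w'), hc, ?_⟩
  have hsub : (u - u', w - w') ∈ S.graph :=
    Submodule.sub_mem _ huw (LinearPMap.le_graph_of_le hle hc)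
  have h1 := norm_add_I_smul_sq (measurable_logNorm N) (mem_conjOperator_graph_iff.1 hsub)
  rw [← map_smul, ← map_add, V.norm_map, V.norm_map, V.norm_map] at h1
  have h2 : ‖w - w' + Complex.I • (u - u')‖ < ε := by
    rw [Metric.mem_ball, dist_comm, dist_eq_norm] at hdist
    have h3 : w - w' + Complex.I • (u - u') = w + Complex.I • u - (w' + Complex.I • u') := by
      rw [smul_sub]
      abel
    rw [h3]
    exact hdist
  rw [Prod.dist_eq, max_lt_iff, dist_eq_norm, dist_eq_norm]
  constructor
  · refine lt_of_le_of_lt (le_of_sq_le_sq ?_ (norm_nonneg _)) h2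
    rw [h1]; simp
  · refine lt_of_le_of_lt (le_of_sq_le_sq ?_ (norm_nonneg _)) h2
    rw [h1]; simp

end Representation

/-! ### The numerical range and the exponentials -/

section Exponential

theorem re_inner_mulOperator_le {X : Type*} [MeasurableSpace X] {μ : Measure X} {h : X → ℝ}
    {a b : Lp ℂ 2 μ} (hab : (a, b) ∈ (mulOperator μ fun x => (h x : ℂ)).graph) {C : ℝ}
    (hC : ∀ᵐ x ∂μ, a x ≠ 0 → h x ≤ C) : (inner ℂ a b : ℂ).re ≤ C * ‖a‖ ^ 2 := by
  rw [mem_mulOperator_graph_iff] at hab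
  have hi : Integrable (fun x => (inner ℂ (a x) (b x) : ℂ)) μ := L2.integrable_inner a b
  have hre : (inner ℂ a b : ℂ).re = ∫ x, (inner ℂ (a x) (b x) : ℂ).re ∂μ := by
    rw [L2.inner_def]
    exact (integral_re hi).symm
  rw [hre, norm_sq_eq_integral, ← integral_const_mul]
  refine integral_mono_ae hi.re ((Lp.memLp a).norm.integrable_sq.const_mul C) ?_
  filter_upwards [hab, hC] with x h1 h2
  have h3 : (inner ℂ (a x) (b x) : ℂ).re = h x * ‖a x‖ ^ 2 := by
    rw [h1, RCLike.inner_apply, mul_assoc, RCLike.mul_conj]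
    rw [← RCLike.ofReal_pow]
    exact Complex.re_ofReal_mul (h x) _
  change (inner ℂ (a x) (b x) : ℂ).re ≤ _
  rw [h3]
  by_cases h0 : a x = 0
  · simp [h0]
  · exact mul_le_mul_of_nonneg_right (h2 h0) (sq_nonneg _)

theorem le_re_inner_mulOperator {X : Type*} [MeasurableSpace X] {μ : Measure X} {h : X → ℝ}
    {a b : Lp ℂ 2 μ} (hab : (a, b) ∈ (mulOperator μ fun x => (h x : ℂ)).graph) {C : ℝ}
    (hC : ∀ᵐ x ∂μ, a x ≠ 0 → C ≤ h x) : C * ‖a‖ ^ 2 ≤ (inner ℂ a b : ℂ).re := by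
  have hneg : (a, -b) ∈ (mulOperator μ fun x => ((-h x : ℝ) : ℂ)).graph := by
    rw [mem_mulOperator_graph_iff] at hab ⊢
    filter_upwards [hab, Lp.coeFn_neg b] with x h1 h2
    rw [h2, Pi.neg_apply, h1]
    simp
  have := re_inner_mulOperator_le hneg (C := -C) (hC.mono fun x hx h0 => neg_le_neg (hx h0))
  rw [inner_neg_right, Complex.neg_re] at this
  linarith

/-- By σ-finiteness the preimage contains a set of finite positive measure, whose indicator serves
as a. -/
theorem exists_supported_of_measure_ne_zero {X : Type*} [MeasurableSpace X] {μ : Measure X}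
    [SigmaFinite μ] {h : X → ℝ} (hh : Measurable h) {s t : ℝ} (hμ : μ (h ⁻¹' Ioo s t) ≠ 0) :
    ∃ a b : Lp ℂ 2 μ, a ≠ 0 ∧ (a, b) ∈ (mulOperator μ fun x => (h x : ℂ)).graph ∧
      ∀ᵐ x ∂μ, a x ≠ 0 → h x ∈ Ioo s t := by
  obtain ⟨A, hAm, hA, hA0, hAt⟩ :=
    Measure.exists_subset_measure_lt_top (hh measurableSet_Ioo) (pos_iff_ne_zero.2 hμ)
  set a : Lp ℂ 2 μ := indicatorConstLp 2 hAm hAt.ne (1 : ℂ) with ha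
  have hac : (a : X → ℂ) =ᵐ[μ] A.indicator fun _ => (1 : ℂ) := indicatorConstLp_coeFn
  have hmem : ∀ᵐ x ∂μ, a x ≠ 0 → h x ∈ Ioo s t := by
    filter_upwards [hac] with x hx h0
    rw [hx] at h0
    exact hA (mem_of_indicator_ne_zero h0)
  have hdom : MemLp (fun x => (h x : ℂ) * a x) 2 μ := by
    refine memLp_mul_of_bound_on (C := max |s| |t|) (by fun_prop) (hmem.mono fun x hx h0 => ?_)
    rw [Complex.norm_real, Real.norm_eq_abs]
    have := hx h0
    exact abs_le_max_abs_abs this.1.le this.2.le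
  refine ⟨a, hdom.toLp _, fun h0 => ?_, mem_mulOperator_graph_iff.2 hdom.coeFn_toLp, hmem⟩
  have h1 : ‖a‖ = 0 := by rw [h0, norm_zero]
  rw [ha, norm_indicatorConstLp (by simp) (by simp)] at h1
  have h2 : 0 < μ.real A := ENNReal.toReal_pos hA0.ne' hAt.ne
  simp only [norm_one, one_mul] at h1
  exact (Real.rpow_pos_of_pos h2 _).ne' h1

instance (N : ℕ) : SigmaFinite (weightedMeasure N) := SigmaFinite.withDensity_ofReal _

theorem weightedMeasure_logNorm_ne_zero {N : ℕ} (hN : 1 ≤ N) {s t : ℝ} (hst : s < t) :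
    weightedMeasure N (logNorm N ⁻¹' Ioo s t) ≠ 0 := by
  have : Nonempty (Fin N) := ⟨⟨0, hN⟩⟩
  have hπ : 0 < 4 * Real.pi := by positivity
  have hpre : logPolar N ⁻¹' (logNorm N ⁻¹' Ioo s t) =
      univ ×ˢ Ioo (s / (4 * Real.pi)) (t / (4 * Real.pi)) := by
    ext z
    simp only [mem_preimage, logNorm, norm_logPolar, Real.log_exp, mem_Ioo, mem_prod, mem_univ,
      true_and]
    rw [div_lt_iff₀' hπ, lt_div_iff₀' hπ]
  rw [← (measurePreserving_logPolar hN).map_eq, (measurableEmbedding_logPolar N).map_apply, hpre,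
    Measure.prod_prod, radialMeasure]
  refine mul_ne_zero ?_ fun h0 => ?_
  · rw [ne_eq, Measure.measure_univ_eq_zero]
    exact Measure.toSphere_ne_zero _
  · have h1 := withDensity_absolutelyContinuous' (μ := (volume : Measure ℝ))
      (f := fun s => ENNReal.ofReal (Real.exp (((N : ℝ) - 2) * s))) (by fun_prop)
      (Filter.Eventually.of_forall fun s => by simp [Real.exp_pos]) h0
    rw [Real.volume_Ioo, ENNReal.ofReal_eq_zero, sub_nonpos] at h1
    exact absurd h1 (not_le.2 (div_lt_div_of_pos_right hst hπ))

/-- The closure of the Euler operator has elements of its graph spectrally localized in any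
interval. -/
theorem eulerClosure_exists_localized {N : ℕ} (hN : 1 ≤ N) {s t : ℝ} (hst : s < t) :
    ∃ u w : WeightedL2 N, u ≠ 0 ∧ (u, w) ∈ (eulerClosure N).graph ∧
      s * ‖u‖ ^ 2 ≤ (inner ℂ u w : ℂ).re ∧ (inner ℂ u w : ℂ).re ≤ t * ‖u‖ ^ 2 := by
  obtain ⟨V, hV⟩ := exists_mellin hN
  obtain ⟨a, b, ha, hab, hs⟩ := exists_supported_of_measure_ne_zero (measurable_logNorm N)
    (weightedMeasure_logNorm_ne_zero hN hst)
  refine ⟨V.symm a, V.symm b, by simpa using ha, ?_, ?_, ?_⟩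
  · rw [eulerClosure_eq hN hV, mem_conjOperator_graph_iff]
    simpa using hab
  · rw [V.symm.inner_map_map, V.symm.norm_map]
    exact le_re_inner_mulOperator hab (hs.mono fun x hx h0 => (hx h0).1.le)
  · rw [V.symm.inner_map_map, V.symm.norm_map]
    exact re_inner_mulOperator_le hab (hs.mono fun x hx h0 => (hx h0).2.le)

/-- On the support of each R.V u boundedness gives Re z · h ≤ log C, hence a one-sided bound on
Re⟨u, Tu⟩. A vector localized beyond that bound contradicts it. -/
theorem re_eq_zero_of_isBounded {N : ℕ} (hN : 1 ≤ N) (R : SpectralRepresentation (eulerClosure N))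
    {z : ℂ} (hb : IsBoundedOperator (R.functionalCalculus fun t => Complex.exp (z * t))) :
    z.re = 0 := by
  let _ := R.measurableSpace
  have hh := R.measurable_h
  obtain ⟨C, hC⟩ := ae_norm_le_of_isBoundedOperator (by fun_prop)
    (conjOperator_isBounded_iff.1 hb)
  have hgraph : ∀ {u w : WeightedL2 N}, (u, w) ∈ (eulerClosure N).graph →
      (R.V u, R.V w) ∈ (mulOperator R.μ fun x => (R.h x : ℂ)).graph := by
    intro u w huw
    rw [R.eq_conj] at huw
    exact mem_conjOperator_graph_iff.1 huw
  have hlog : ∀ u : WeightedL2 N, ∀ᵐ x ∂(R.μ), R.V u x ≠ 0 → z.re * R.h x ≤ Real.log C := by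
    intro u
    filter_upwards [hC (R.V u)] with x hx h0
    have h1 := hx h0
    rw [Complex.norm_exp] at h1
    simp only [Complex.mul_re, Complex.ofReal_re, Complex.ofReal_im, mul_zero, sub_zero] at h1
    exact (Real.le_log_iff_exp_le ((Real.exp_pos _).trans_le h1)).2 h1
  -- For Re z < 0 the bound on h is from below by log C / Re z, so the localizing interval lies to
  -- its left; for Re z > 0 it lies to the right.
  rcases lt_trichotomy z.re 0 with hz | hz | hz
  · obtain ⟨u, w, hu, huw, -, h2⟩ := eulerClosure_exists_localized hN
      (show Real.log C / z.re - 2 < Real.log C / z.re - 1 by linarith)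
    have h3 := le_re_inner_mulOperator (hgraph huw) (C := Real.log C / z.re)
      ((hlog u).mono fun x hx h0 => (div_le_iff_of_neg' hz).2 (hx h0))
    rw [R.V.inner_map_map, R.V.norm_map] at h3
    have h4 : 0 < ‖u‖ ^ 2 := pow_pos (norm_pos_iff.2 hu) 2
    nlinarith
  · exact hz
  · obtain ⟨u, w, hu, huw, h2, -⟩ := eulerClosure_exists_localized hN
      (show Real.log C / z.re + 1 < Real.log C / z.re + 2 by linarith)
    have h3 := re_inner_mulOperator_le (hgraph huw) (C := Real.log C / z.re)
      ((hlog u).mono fun x hx h0 => (le_div_iff₀' hz).2 (hx h0))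
    rw [R.V.inner_map_map, R.V.norm_map] at h3
    have h4 : 0 < ‖u‖ ^ 2 := pow_pos (norm_pos_iff.2 hu) 2
    nlinarith

theorem isUnitary_exp_of_re_eq_zero {H : Type*} [NormedAddCommGroup H] [InnerProductSpace ℂ H]
    [CompleteSpace H] {T : H →ₗ.[ℂ] H} (R : SpectralRepresentation T) {z : ℂ} (hz : z.re = 0) :
    IsUnitaryOperator (R.functionalCalculus fun t => Complex.exp (z * t)) := by
  let _ := R.measurableSpace
  have hh := R.measurable_h
  obtain ⟨W, hW⟩ := mulOperator_isUnitary (μ := R.μ)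
    (g := fun x => Complex.exp (z * R.h x)) (by fun_prop) fun x => by
      rw [Complex.norm_exp]
      simp [hz]
  exact conjOperator_isUnitary W hW

theorem IsUnitaryOperator.isBounded {H : Type*} [NormedAddCommGroup H] [InnerProductSpace ℂ H]
    [CompleteSpace H] {S : H →ₗ.[ℂ] H} (hS : IsUnitaryOperator S) : IsBoundedOperator S := by
  obtain ⟨U, -, rfl⟩ := hS
  exact ⟨‖U‖, fun u => U.le_opNorm u⟩

end Exponential

/-! ### Conclusion -/

theorem mainTheorem8 (N : ℕ) (hN : 1 ≤ N) (z : ℂ) :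
    Nonempty (SpectralRepresentation (eulerClosure N)) ∧
    ∀ R : SpectralRepresentation (eulerClosure N),
      IsNormalOperator (R.functionalCalculus (fun t => Complex.exp (z * t))) ∧
      (IsBoundedOperator (R.functionalCalculus (fun t => Complex.exp (z * t))) ↔ z.re = 0) ∧
      (z.re = 0 → IsUnitaryOperator (R.functionalCalculus (fun t => Complex.exp (z * t)))) := by
  constructor
  · obtain ⟨V, hV⟩ := exists_mellin hN
    exact ⟨{ X := EuclideanSpace ℝ (Fin N), μ := weightedMeasure N, V := V, h := logNorm N,
             measurable_h := measurable_logNorm N, eq_conj := eulerClosure_eq hN hV }⟩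
  · intro R
    refine ⟨?_, ⟨re_eq_zero_of_isBounded hN R,
      fun hz => (isUnitary_exp_of_re_eq_zero R hz).isBounded⟩, isUnitary_exp_of_re_eq_zero R⟩
    let _ := R.measurableSpace
    have hh := R.measurable_h
    exact conjOperator_isNormal (mulOperator_isNormal (by fun_prop))
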